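/- A run-length straight-line program (RLSLP) is a context-free grammar with linearly ordered variables in which every variable $A$ has exactly one rule, of the form $A\to a$ ($a$ a terminal symbol), $A\to A_1A_2\cdots A_k$ ($k>1$), or $A\to B^t$ ($t>2$), the variables on the right-hand side being smaller than $A$; it generates the string derived from its greatest variable. Its size is the sum of the lengths of the right-hand sides, where a rule $A\to B^t$ counts as $2$. For a nonempty string $w$ let $g_{rl}(w)$ be the smallest size of an RLSLP that generates $w$. The model is the word RAM with words of $b$ bits: unit-cost arithmetic, bitwise and comparison instructions, finitely many registers, a read-only array of words (the index), and a random-access working memory; registers and working memory may hold arbitrary values at the start of a computation. Theorem. There is an absolute constant $C$ such that for every word-RAM program $H$ there is a word-RAM program $Q$, depending only on $H$, with the following property. Let $w=w_1\cdots w_n$ be a string of length $n\ge 2$. Let $f$ be a function from strings to a set $S$ of size $n^{O(1)}$, let the elements of $S$ be coded injectively by words of $b$ bits, where $2^b\ge Cn$ (so $b=\Theta(\log n)$ can be chosen), and let $h$ be a function such that $$f(xy)=h(f(x),f(y),|x|,|y|)\quad\text{for all strings } x,y.$$ Suppose that $H$, given $u,v\in S$ and lengths $\ell_1,\ell_2\ge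 0$ with $\ell_1+\ell_2\le n$, computes $h(u,v,\ell_1,\ell_2)$ in at most $T$ steps with at most $s$ cells of working memory, without relying on the content of the read-only array. Then there is an index of at most $C\cdot g_{rl}(w)$ words with which $Q$, given any $i\in\{1,\dots,n\}$ and $j\in\{0,\dots,n\}$, computes $f(w[i:j])$ in at most $C\cdot T\cdot\lfloor\log_2 n\rfloor$ steps, with at most $s$ cells of working memory. Here $w[i:j]=w_i\cdots w_j$, which is the empty string if $j<i$. -/

import Mathlib

/-! ### Strings -/

/-- The substring `w[i : j] = w_i … w_j` (positions counted from 1), which is empty if `j < i`. -/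
def substr {α : Type*} (w : List α) (i j : ℕ) : List α :=
  (w.take j).drop (i - 1)

/-! ### Run-length straight-line programs -/

/-- The right-hand side of a rule of an RLSLP that may refer only to the variables `0, …, i - 1`. -/
inductive RLRule (α : Type*) (i : ℕ) where
  /-- `A → a` for a terminal symbol `a`. -/
  | term (a : α)
  /-- `A → A₁ A₂ ⋯ A_k` for variables `A₁, …, A_k` and `k > 1`. -/
  | concat (rhs : List (Fin i)) (hk : 1 < rhs.length)
  /-- `A → B ^ t` for a variable `B` and `t > 2`. -/
  | run (B : Fin i) (t : ℕ) (ht : 2 < t)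

/-- The size of a right-hand side: its length, except that a run-length rule has size 2. -/
def RLRule.size {α : Type*} {i : ℕ} : RLRule α i → ℕ
  | .term _ => 1
  | .concat rhs _ => rhs.length
  | .run _ _ _ => 2

/-- A run-length straight-line program over `α`. The variables are `0, 1, …, start`; every variable
has exactly one rule, the rule of a variable refers only to strictly smaller variables, and the
initial variable is the greatest one. -/
structure RLSLP (α : Type*) where
  start : ℕ
  rule : (A : Fin (start + 1)) → RLRule α A

namespace RLSLP

variable {α : Type*}

/-- The string derived from a variable. -/
def exp (G : RLSLP α) (A : Fin (G.start + 1)) : List α :=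
  match G.rule A with
  | .term a => [a]
  | .concat rhs _ => rhs.flatMap fun (B : Fin A) => G.exp ⟨B, B.isLt.trans A.isLt⟩
  | .run B t _ => (List.replicate t (G.exp ⟨B, lt_trans B.isLt A.isLt⟩)).flatten
termination_by A.val
decreasing_by all_goals exact B.isLt

/-- The string generated by the RLSLP. -/
def word (G : RLSLP α) : List α := G.exp (Fin.last G.start)

/-- The size of the RLSLP: the sum of the sizes of its rules. -/
def size (G : RLSLP α) : ℕ := ∑ A, (G.rule A).size

end RLSLP

/-- `g_rl`: the size of the smallest RLSLP generating `w` (every nonempty `w` has one). -/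
noncomputable def gRl {α : Type*} (w : List α) : ℕ :=
  sInf {m | ∃ G : RLSLP α, G.word = w ∧ G.size = m}

/-! ### The word RAM

Words have `b` bits. A machine has a read-only array of words (the index), registers numbered by
`ℕ` (each program mentions only finitely many), and a random-access working memory with `s` cells.
Every elementary instruction and every test takes one step. Registers and working memory are not
assumed to be initialised. -/

namespace WordRAM

/-- Arithmetic and bitwise operations on words. -/
inductive Op where
  | add | sub | mul | div | mod | and | or | xor | shl | shr

/-- Arithmetic is unsigned, modulo `2 ^ b`. -/
def Op.eval {b : ℕ} : Op → BitVec b → BitVec b → BitVec b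
  | .add, x, y => x + y
  | .sub, x, y => x - y
  | .mul, x, y => x * y
  | .div, x, y => x / y
  | .mod, x, y => x % y
  | .and, x, y => x &&& y
  | .or, x, y => x ||| y
  | .xor, x, y => x ^^^ y
  | .shl, x, y => x <<< y.toNat
  | .shr, x, y => x >>> y.toNat

/-- The contents of the registers and of the working memory. -/
structure State (b : ℕ) where
  reg : ℕ → BitVec b
  mem : ℕ → BitVec b

/-- Assign a word to a register. -/
def State.setReg {b : ℕ} (σ : State b) (r : ℕ) (v : BitVec b) : State b :=
  { σ with reg := Function.update σ.reg r v }

/-- Assign a word to a cell of the working memory. -/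
def State.setMem {b : ℕ} (σ : State b) (a : ℕ) (v : BitVec b) : State b :=
  { σ with mem := Function.update σ.mem a v }

/-- Comparisons of two registers. -/
inductive Test where
  | eq (x y : ℕ)
  | lt (x y : ℕ)

/-- Truth of a comparison (unsigned). -/
def Test.Holds {b : ℕ} (σ : State b) : Test → Prop
  | .eq x y => σ.reg x = σ.reg y
  | .lt x y => (σ.reg x).toNat < (σ.reg y).toNat

/-- Programs; `r`, `x`, `y`, `a` are register numbers. -/
inductive Prog where
  /-- do nothing -/
  | skip
  /-- `reg r := k` -/
  | const (r k : ℕ)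
  /-- `reg r := reg x` -/
  | move (r x : ℕ)
  /-- `reg r := reg x ∘ reg y` -/
  | op (o : Op) (r x y : ℕ)
  /-- `reg r := index[reg a]` -/
  | read (r a : ℕ)
  /-- `reg r := mem[reg a]` -/
  | load (r a : ℕ)
  /-- `mem[reg a] := reg x` -/
  | store (a x : ℕ)
  /-- first `P`, then `Q` -/
  | seq (P Q : Prog)
  /-- if `c` then `P` else `Q` -/
  | ite (c : Test) (P Q : Prog)
  /-- while `c` do `P` -/
  | loop (c : Test) (P : Prog)

/-- `Exec D s P σ t σ'`: with read-only array `D` and `s` cells of working memory, `P` started in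
state `σ` halts after exactly `t` steps in state `σ'`. An access outside `D` or outside the working
memory makes the program fail. -/
inductive Exec {b : ℕ} (D : List (BitVec b)) (s : ℕ) :
    Prog → State b → ℕ → State b → Prop where
  | skip (σ : State b) : Exec D s .skip σ 1 σ
  | const (σ : State b) (r k : ℕ) :
      Exec D s (.const r k) σ 1 (σ.setReg r (BitVec.ofNat b k))
  | move (σ : State b) (r x : ℕ) : Exec D s (.move r x) σ 1 (σ.setReg r (σ.reg x))
  | op (σ : State b) (o : Op) (r x y : ℕ) :
      Exec D s (.op o r x y) σ 1 (σ.setReg r (o.eval (σ.reg x) (σ.reg y)))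
  | read (σ : State b) (r a : ℕ) (h : (σ.reg a).toNat < D.length) :
      Exec D s (.read r a) σ 1 (σ.setReg r D[(σ.reg a).toNat])
  | load (σ : State b) (r a : ℕ) (h : (σ.reg a).toNat < s) :
      Exec D s (.load r a) σ 1 (σ.setReg r (σ.mem (σ.reg a).toNat))
  | store (σ : State b) (a x : ℕ) (h : (σ.reg a).toNat < s) :
      Exec D s (.store a x) σ 1 (σ.setMem (σ.reg a).toNat (σ.reg x))
  | seq {P Q : Prog} {σ σ₁ σ₂ : State b} {t₁ t₂ : ℕ}
      (h₁ : Exec D s P σ t₁ σ₁) (h₂ : Exec D s Q σ₁ t₂ σ₂) :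
      Exec D s (.seq P Q) σ (t₁ + t₂) σ₂
  | ite_true {c : Test} {P Q : Prog} {σ σ₁ : State b} {t : ℕ}
      (hc : c.Holds σ) (h : Exec D s P σ t σ₁) : Exec D s (.ite c P Q) σ (t + 1) σ₁
  | ite_false {c : Test} {P Q : Prog} {σ σ₁ : State b} {t : ℕ}
      (hc : ¬ c.Holds σ) (h : Exec D s Q σ t σ₁) : Exec D s (.ite c P Q) σ (t + 1) σ₁
  | loop_true {c : Test} {P : Prog} {σ σ₁ σ₂ : State b} {t₁ t₂ : ℕ}
      (hc : c.Holds σ) (h₁ : Exec D s P σ t₁ σ₁) (h₂ : Exec D s (.loop c P) σ₁ t₂ σ₂) :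
      Exec D s (.loop c P) σ (t₁ + t₂ + 1) σ₂
  | loop_false {c : Test} {P : Prog} {σ : State b} (hc : ¬ c.Holds σ) :
      Exec D s (.loop c P) σ 1 σ

/-- With read-only array `D` and `s` cells of working memory, the program `P`, given the words
`args` in the registers `0, 1, …`, returns `v` in register `0` within `T` steps, whatever the other
registers and the working memory contain at the beginning. -/
def Prog.Computes {b : ℕ} (P : Prog) (D : List (BitVec b)) (s T : ℕ)
    (args : List (BitVec b)) (v : BitVec b) : Prop :=
  ∀ σ : State b, (∀ (i : ℕ) (hi : i < args.length), σ.reg i = args[i]) →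
    ∃ t ≤ T, ∃ σ' : State b, Exec D s P σ t σ' ∧ σ'.reg 0 = v

end WordRAM

/-!
# Factor queries on run-length grammars

An RLSLP can be balanced: at the cost of a constant factor in size, its derivation tree gets depth
`O(log n)`, even if a run `u ^ t` counts as `1 + log₂ t` levels. A query on the balanced grammar walks
down a constant number of root-to-leaf paths and combines the stored values of the variables that hang
off these paths; a power `u ^ q` in the middle of a run is evaluated in `O(log q)` steps by repeated
squaring. Since `1 + log₂ t` levels have been charged for the run, the total number of evaluations of
`h` is `O(log n)`.

Variables are identified with the words that they derive. A grammar is then a finite set `W` of words,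
and `Der W x d` says that `x` can be derived inside `W` with (weighted) depth `d`. This makes the size
of the new grammar the cardinality of a union of finite sets, and the order of its variables is the
order by rank.

*Balancing* (`WordGrammar.exists_balanced`). Let `occ w x` be the number of occurrences of `x` in the
derivation tree of `w`. Link `x` to its child `y` if `⌊log₂ |x|⌋ = ⌊log₂ |y|⌋` and
`⌊log₂ (occ w x)⌋ = ⌊log₂ (occ w y)⌋`. Since `occ w x * |x| ≤ n`, a path from the root has only
`O(log n)` edges that are not links. Every word has at most one link to a child, because the lengths
of children add up, and at most one from a parent, because the numbers of occurrences add up. So the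
links form disjoint paths, the symmetric centroid paths, and no link starts at a run. A path from its
vertex `x` on derives `x` by wrapping the last vertex in the siblings along the path, and
`exists_contexts` provides balanced derivations of all of these words, with a constant number of new
words for each vertex, by a weight-balanced binary search tree: entering the path at `x` and leaving it
for the sibling at `z` costs `O(1 + log (Q / q x) + log (Q / q z))`, where `q` are the weights and `Q`
is their sum. The weight of a vertex has two terms of the same order in total, one proportional to the
length of its sibling and one proportional to the number of its occurrences that are not reached along
the path. Thus the cost of leaving telescopes along a path from the root with the lengths, and the cost
of entering telescopes with the numbers of occurrences, so that all of it adds up to `O(log n)`.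

*Queries*. In the index (`WordRAM.IsIndex`), every word has a record of five cells, with rules of the
form `x = u ^ c v`. The query program (`WordRAM.query`) descends to the rule at which the factor is
split (`WordRAM.descend_spec`); from there the factor consists of a suffix of a word, some copies of
this word, and a prefix of another word. A prefix or suffix is a sequence of powers met on a single
path (`WordRAM.walk_spec`), and the values are accumulated from left to right or from right to left, so
that no stack is needed and the working memory is left to the program for `h`. The correctness and
running time of programs are expressed by `WordRAM.Spec`, which describes the private registers by
natural numbers.
-/

/-! ### Derivations inside a set of words -/

/-- `Der W x d`: the word `x` has a derivation all of whose intermediate words lie in `W`, of rank at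
most `d`. The productions are those of an RLSLP with binary concatenations, and nodes are identified
with the words they derive. A concatenation costs `1` and a run `u ^ t` costs `1 + log₂ t`, which is
what a query pays for passing through it. -/
inductive Der {α : Type*} (W : Finset (List α)) : List α → ℕ → Prop
  | leaf {a : α} {d : ℕ} (h : [a] ∈ W) : Der W [a] d
  | cat {u v : List α} {d d' : ℕ} (hu : Der W u d) (hv : Der W v d) (hd : d < d')
      (h : u ++ v ∈ W) : Der W (u ++ v) d'
  | run {u : List α} {t d d' : ℕ} (hu : Der W u d) (ht : 2 < t) (hd : d + Nat.log 2 t < d')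
      (h : (List.replicate t u).flatten ∈ W) : Der W (List.replicate t u).flatten d'

namespace Der

variable {α : Type*} {W : Finset (List α)} {x y : List α} {d d' : ℕ}

theorem mono (h : Der W x d) (hd : d ≤ d') : Der W x d' := by
  cases h with
  | leaf h => exact .leaf h
  | cat hu hv hlt h => exact .cat hu hv (by omega) h
  | run hu ht hlt h => exact .run hu ht (by omega) h

theorem mem (h : Der W x d) : x ∈ W := by
  cases h <;> assumption

theorem ne_nil (h : Der W x d) : x ≠ [] := by
  induction h with
  | leaf h => simp
  | cat hu hv hlt h ihu ihv => simp [ihu]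
  | run hu ht hlt h ih =>
    simp only [ne_eq, List.flatten_eq_nil_iff, List.mem_replicate, not_forall]
    exact ⟨_, ⟨by omega, rfl⟩, ih⟩

end Der

/-- `Der`, or the word is empty. Empty words occur as missing siblings along a path. -/
def DerOrNil {α : Type*} (W : Finset (List α)) (x : List α) (d : ℕ) : Prop :=
  x = [] ∨ Der W x d

namespace DerOrNil

variable {α : Type*} {W : Finset (List α)} {x y : List α} {d d' : ℕ}

theorem nil : DerOrNil W ([] : List α) d := Or.inl rfl

theorem mono (h : DerOrNil W x d) (hd : d ≤ d') : DerOrNil W x d' :=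
  h.imp id fun h => h.mono hd

theorem append (hx : DerOrNil W x d) (hy : DerOrNil W y d) (h : x ++ y ∈ W) :
    DerOrNil W (x ++ y) (d + 1) := by
  rcases hx with rfl | hx
  · simpa using hy.mono (Nat.le_succ d)
  rcases hy with rfl | hy
  · simpa using DerOrNil.mono (Or.inr hx) (Nat.le_succ d)
  · exact Or.inr (.cat hx hy (Nat.lt_succ_self d) h)

end DerOrNil

/-! ### Balancing a sequence of nested contexts -/

section Contexts

variable {ι α : Type*} (L R : ι → List α) (q : ι → ℕ)

/-- The word obtained from `y` by wrapping it in the contexts `L i · R i`, the first element of the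
list being the outermost. -/
def wrap (l : List ι) (y : List α) : List α :=
  l.foldr (fun i z => L i ++ z ++ R i) y

theorem wrap_cons (i : ι) (l : List ι) (y : List α) :
    wrap L R (i :: l) y = L i ++ wrap L R l y ++ R i := rfl

theorem wrap_append (l₁ l₂ : List ι) (y : List α) :
    wrap L R (l₁ ++ l₂) y = wrap L R l₁ (wrap L R l₂ y) := by
  simp [wrap]

/-- The left part of the composed context. -/
def leftPart (l : List ι) : List α := l.flatMap L

/-- The right part of the composed context. -/
def rightPart (l : List ι) : List α := l.reverse.flatMap R

theorem wrap_eq (l : List ι) (y : List α) :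
    wrap L R l y = leftPart L l ++ y ++ rightPart R l := by
  induction l with
  | nil => simp [wrap, leftPart, rightPart]
  | cons i l ih => rw [wrap_cons, ih]; simp [leftPart, rightPart]

theorem exists_split_of_lt_sum (l : List ι) (m : ℕ) (hm : m < (l.map q).sum) :
    ∃ l₁ i l₂, l = l₁ ++ i :: l₂ ∧ (l₁.map q).sum ≤ m ∧ m < (l₁.map q).sum + q i := by
  induction l generalizing m with
  | nil => simp at hm
  | cons j l ih =>
    by_cases hj : m < q j
    · exact ⟨[], j, l, rfl, by simp, by simpa using hj⟩
    · obtain ⟨l₁, i, l₂, rfl, h₁, h₂⟩ := ih (m - q j) (by simp at hm ⊢; omega)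
      exact ⟨j :: l₁, i, l₂, rfl, by simp; omega, by simp; omega⟩

/-- A weighted median of a nonempty list. -/
theorem exists_median (l : List ι) (hpos : 0 < (l.map q).sum) :
    ∃ l₁ i l₂, l = l₁ ++ i :: l₂ ∧ 2 * (l₁.map q).sum ≤ (l.map q).sum ∧
      2 * (l₂.map q).sum ≤ (l.map q).sum := by
  obtain ⟨l₁, i, l₂, h, h₁, h₂⟩ :=
    exists_split_of_lt_sum q l ((l.map q).sum / 2) (Nat.div_lt_self hpos (by norm_num))
  have hs : (l.map q).sum = (l₁.map q).sum + (q i + (l₂.map q).sum) := by simp [h]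
  exact ⟨l₁, i, l₂, h, by omega, by omega⟩

theorem le_sum_of_mem {l : List ι} {i : ι} (h : i ∈ l) : q i ≤ (l.map q).sum :=
  List.single_le_sum (by simp) _ (List.mem_map_of_mem h)

theorem log_add_one_le {l l' : List ι} {i : ι} (hi : i ∈ l) (hq : 0 < q i)
    (h : 2 * (l.map q).sum ≤ (l'.map q).sum) :
    Nat.log 2 (l.map q).sum + 1 ≤ Nat.log 2 (l'.map q).sum := by
  have h1 : (l.map q).sum ≠ 0 := by have := le_sum_of_mem q hi; omega
  calc Nat.log 2 (l.map q).sum + 1 = Nat.log 2 ((l.map q).sum * 2) :=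
        (Nat.log_mul_base (by norm_num) h1).symm
    _ ≤ _ := Nat.log_mono_right (by omega)

/-- Linearly many words suffice to derive all contexts along a path, in such a way that the distance
from the `k`-th suffix context to the `m`-th sibling is of the order
`log (Q / q k) + log (Q / q m)`, where `Q` is the total weight. The recursion is that of a
weight-balanced binary search tree; the tail `y` carries everything to the right of the current
subtree, so that only a constant number of words is created per node of the tree. -/
theorem exists_contexts (n : ℕ) : ∀ (l : List ι) (y : List α), l.length ≤ n → (∀ i ∈ l, 0 < q i) →
    ∃ S : Finset (List α), S.card ≤ 8 * l.length ∧ ∀ W : Finset (List α), S ⊆ W →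
      ∀ (e : ι → ℕ) (d : ℕ), (∀ i ∈ l, DerOrNil W (L i) (e i) ∧ DerOrNil W (R i) (e i) ∧
          e i + 4 * (Nat.log 2 (l.map q).sum - Nat.log 2 (q i)) ≤ d) →
        DerOrNil W (leftPart L l) (d + 2) ∧ DerOrNil W (rightPart R l) (d + 2) ∧
        ∀ g, d + 2 ≤ g → DerOrNil W y g → ∀ i l', i :: l' <:+ l →
          DerOrNil W (wrap L R (i :: l') y)
            (g + 4 * (Nat.log 2 (l.map q).sum - Nat.log 2 (q i)) + 4) := by
  classical
  induction n with
  | zero =>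
    intro l y hl _
    obtain rfl : l = [] := List.length_eq_zero_iff.mp (by omega)
    exact ⟨∅, by simp, fun W _ e d _ => ⟨.nil, .nil, fun g _ _ i l' h => by simp at h⟩⟩
  | succ n ih =>
    intro l y hl hq
    rcases List.eq_nil_or_concat l with rfl | hne
    · exact ⟨∅, by simp, fun W _ e d _ => ⟨.nil, .nil, fun g _ _ i l' h => by simp at h⟩⟩
    have hpos : 0 < (l.map q).sum := by
      obtain ⟨l', i, rfl⟩ := hne
      have h1 := hq i (by simp)
      have h2 := le_sum_of_mem q (l := l' ++ [i]) (i := i) (by simp)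
      simp only [List.concat_eq_append] at *
      omega
    obtain ⟨l₁, x, l₂, hl12, hm₁, hm₂⟩ := exists_median q l hpos
    have hmem₁ : ∀ i ∈ l₁, i ∈ l := fun i hi => by simp [hl12, hi]
    have hmem₂ : ∀ i ∈ l₂, i ∈ l := fun i hi => by simp [hl12, hi]
    have hmemx : x ∈ l := by simp [hl12]
    have hlen : l.length = l₁.length + l₂.length + 1 := by simp [hl12]; omega
    set A := leftPart L l₂ ++ y with hA
    set B := A ++ rightPart R l₂ with hB
    set E := L x ++ B with hE
    set F := E ++ R x with hF
    obtain ⟨S₁, hc₁, hS₁⟩ := ih l₁ F (by omega) fun i hi => hq i (hmem₁ i hi)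
    obtain ⟨S₂, hc₂, hS₂⟩ := ih l₂ y (by omega) fun i hi => hq i (hmem₂ i hi)
    have hLl : leftPart L l = leftPart L l₁ ++ (L x ++ leftPart L l₂) := by
      simp [hl12, leftPart]
    have hRl : rightPart R l = (rightPart R l₂ ++ R x) ++ rightPart R l₁ := by
      simp [hl12, rightPart]
    have hFw : F = wrap L R (x :: l₂) y := by
      rw [wrap_cons, wrap_eq]
    refine ⟨S₁ ∪ S₂ ∪ {A, B, E, F, L x ++ leftPart L l₂, rightPart R l₂ ++ R x,
      leftPart L l, rightPart R l}, ?_, ?_⟩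
    · refine (Finset.card_union_le _ _).trans ?_
      have h1 := Finset.card_union_le S₁ S₂
      have h2 : ({A, B, E, F, L x ++ leftPart L l₂, rightPart R l₂ ++ R x,
        leftPart L l, rightPart R l} : Finset (List α)).card ≤ 8 := 
        (Finset.card_insert_le _ _).trans (Nat.succ_le_succ
          ((Finset.card_insert_le _ _).trans (Nat.succ_le_succ Finset.card_le_six)))
      omega
    intro W hW e d hd
    have hW₁ : S₁ ⊆ W := fun z hz => hW (by simp [hz])
    have hW₂ : S₂ ⊆ W := fun z hz => hW (by simp [hz])
    have hWs : ∀ z ∈ ({A, B, E, F, L x ++ leftPart L l₂, rightPart R l₂ ++ R x,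
        leftPart L l, rightPart R l} : Finset (List α)), z ∈ W :=
      fun z hz => hW (Finset.mem_union_right _ hz)
    -- the halves lose a factor two in total weight, which pays for four steps
    have key : ∀ l' : List ι, (∀ i ∈ l', i ∈ l) → 2 * (l'.map q).sum ≤ (l.map q).sum → ∀ i ∈ l',
        4 * (Nat.log 2 (l'.map q).sum - Nat.log 2 (q i)) + 4 ≤
          4 * (Nat.log 2 (l.map q).sum - Nat.log 2 (q i)) := by
      intro l' hl' hs i hi
      have h1 := log_add_one_le q hi (hq i (hl' i hi)) hs
      have h2 : Nat.log 2 (q i) ≤ Nat.log 2 (l'.map q).sum :=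
        Nat.log_mono_right (le_sum_of_mem q hi)
      omega
    have whole : ∀ l' : List ι, (∀ i ∈ l', i ∈ l) → 2 * (l'.map q).sum ≤ (l.map q).sum →
        (∀ d, (∀ i ∈ l', DerOrNil W (L i) (e i) ∧ DerOrNil W (R i) (e i) ∧
          e i + 4 * (Nat.log 2 (l'.map q).sum - Nat.log 2 (q i)) ≤ d) →
        DerOrNil W (leftPart L l') (d + 2) ∧ DerOrNil W (rightPart R l') (d + 2)) →
        DerOrNil W (leftPart L l') d ∧ DerOrNil W (rightPart R l') d := by
      intro l' hl' hs h
      rcases List.eq_nil_or_concat l' with rfl | ⟨l'', j, rfl⟩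
      · exact ⟨.nil, .nil⟩
      have hj := key _ hl' hs j (by simp)
      have hj' := (hd j (hl' j (by simp))).2.2
      have h3 := h (d - 4) fun i hi => by
        have h1 := key _ hl' hs i hi
        obtain ⟨a, b, c⟩ := hd i (hl' i hi)
        exact ⟨a, b, by omega⟩
      exact ⟨h3.1.mono (by omega), h3.2.mono (by omega)⟩
    obtain ⟨hL₁, hR₁⟩ := whole l₁ hmem₁ hm₁ fun d h =>
      ⟨(hS₁ W hW₁ e d h).1, (hS₁ W hW₁ e d h).2.1⟩
    obtain ⟨hL₂, hR₂⟩ := whole l₂ hmem₂ hm₂ fun d h =>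
      ⟨(hS₂ W hW₂ e d h).1, (hS₂ W hW₂ e d h).2.1⟩
    obtain ⟨hLx, hRx, hex⟩ := hd x hmemx
    replace hLx := hLx.mono (show e x ≤ d by omega)
    replace hRx := hRx.mono (show e x ≤ d by omega)
    refine ⟨?_, ?_, ?_⟩
    · rw [hLl]
      exact (hL₁.mono (Nat.le_succ d)).append (hLx.append hL₂ (hWs _ (by simp)))
        (hLl ▸ hWs _ (by simp))
    · rw [hRl]
      exact (hR₂.append hRx (hWs _ (by simp))).append (hR₁.mono (Nat.le_succ d))
        (hRl ▸ hWs _ (by simp))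
    intro g hg hy i l' hsuf
    have hA' : DerOrNil W A (g + 1) :=
      (hL₂.mono (by omega)).append hy (hWs A (by simp))
    have hB' : DerOrNil W B (g + 2) :=
      hA'.append (hR₂.mono (by omega)) (hWs B (by simp))
    have hE' : DerOrNil W E (g + 3) :=
      (hLx.mono (by omega)).append hB' (hWs E (by simp))
    have hF' : DerOrNil W F (g + 4) :=
      hE'.append (hRx.mono (by omega)) (hWs F (by simp))
    have hd₁ : ∀ i ∈ l₁, DerOrNil W (L i) (e i) ∧ DerOrNil W (R i) (e i) ∧
        e i + 4 * (Nat.log 2 (l₁.map q).sum - Nat.log 2 (q i)) ≤ d := fun i hi => by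
      obtain ⟨a, b, c⟩ := hd i (hmem₁ i hi)
      have := key l₁ hmem₁ hm₁ i hi
      exact ⟨a, b, by omega⟩
    have hd₂ : ∀ i ∈ l₂, DerOrNil W (L i) (e i) ∧ DerOrNil W (R i) (e i) ∧
        e i + 4 * (Nat.log 2 (l₂.map q).sum - Nat.log 2 (q i)) ≤ d := fun i hi => by
      obtain ⟨a, b, c⟩ := hd i (hmem₂ i hi)
      have := key l₂ hmem₂ hm₂ i hi
      exact ⟨a, b, by omega⟩
    obtain ⟨t, ht⟩ := hsuf
    rw [hl12, List.append_eq_append_iff] at ht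
    -- the suffix starts in the right half or at the median, or it starts in the left half
    rcases ht with ⟨m, hm, hm'⟩ | ⟨m, hm, hm'⟩
    · cases m with
      | nil =>
        obtain ⟨rfl, rfl⟩ : i = x ∧ l' = l₂ := by simpa using hm'
        exact hFw ▸ hF'.mono (by omega)
      | cons j m =>
        obtain ⟨rfl, rfl⟩ : i = j ∧ l' = m ++ x :: l₂ := by simpa using hm'
        have hi : i ∈ l₁ := by simp [hm]
        have h1 := key l₁ hmem₁ hm₁ i hi
        have h2 := (hS₁ W hW₁ e d hd₁).2.2 (g + 4) (by omega) hF' i m ⟨t, hm.symm⟩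
        rw [hFw, ← wrap_append] at h2
        exact h2.mono (by omega)
    · cases m with
      | nil =>
        obtain ⟨rfl, rfl⟩ : x = i ∧ l₂ = l' := by simpa using hm'
        exact hFw ▸ hF'.mono (by omega)
      | cons j m =>
        obtain ⟨rfl, rfl⟩ : x = j ∧ l₂ = m ++ i :: l' := by simpa using hm'
        have h1 := key _ hmem₂ hm₂ i (by simp)
        exact ((hS₂ W hW₂ e d hd₂).2.2 g hg hy i l' ⟨m, rfl⟩).mono (by omega)

end Contexts

/-! ### Grammars whose variables are words -/

/-- A grammar whose variables are identified with the words that they derive. `ch x` is the right-hand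
side of the rule of `x`, a list of words; it is empty for a word that is a terminal symbol. -/
structure WordGrammar (α : Type*) where
  V : Finset (List α)
  ch : List α → List (List α)
  shape : ∀ x, ch x = [] ∨
    (∃ u v, u ≠ [] ∧ v ≠ [] ∧ ch x = [u, v] ∧ x = u ++ v) ∨
    (∃ u t, u ≠ [] ∧ 2 < t ∧ ch x = List.replicate t u ∧ x = (List.replicate t u).flatten)
  mem : ∀ x ∈ V, ∀ c ∈ ch x, c ∈ V
  leaf : ∀ x ∈ V, ch x = [] → ∃ a, x = [a]

namespace WordGrammar

open scoped Classical

variable {α : Type*} (G : WordGrammar α)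

theorem ne_nil_of_mem_ch {x c : List α} (h : c ∈ G.ch x) : c ≠ [] := by
  rcases G.shape x with h0 | ⟨u, v, hu, hv, h1, -⟩ | ⟨u, t, hu, -, h1, -⟩
  · simp [h0] at h
  · rw [h1] at h
    rcases List.mem_pair.mp h with rfl | rfl <;> assumption
  · rw [h1] at h
    rwa [List.eq_of_mem_replicate h]

theorem sum_length_ch {x c : List α} (h : c ∈ G.ch x) :
    ((G.ch x).map List.length).sum = x.length := by
  rcases G.shape x with h0 | ⟨u, v, hu, hv, h1, h2⟩ | ⟨u, t, hu, -, h1, h2⟩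
  · simp [h0] at h
  · rw [h1, h2]; simp
  · rw [h1, ← List.length_flatten, ← h2]

theorem sum_length_ch_le (x : List α) : ((G.ch x).map List.length).sum ≤ x.length := by
  rcases h : G.ch x with _ | ⟨c, l⟩
  · simp
  · rw [← h, G.sum_length_ch (c := c) (by simp [h])]

theorem length_lt_of_mem_ch {x c : List α} (h : c ∈ G.ch x) : c.length < x.length := by
  have hc := List.length_pos_of_ne_nil (G.ne_nil_of_mem_ch h)
  rcases G.shape x with h0 | ⟨u, v, hu, hv, h1, h2⟩ | ⟨u, t, hu, ht, h1, h2⟩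
  · simp [h0] at h
  · rw [h1] at h
    have hu := List.length_pos_of_ne_nil hu
    have hv := List.length_pos_of_ne_nil hv
    rcases List.mem_pair.mp h with rfl | rfl <;> simp [h2] <;> assumption
  · rw [h1] at h
    obtain rfl := List.eq_of_mem_replicate h
    rw [h2]
    simp only [List.length_flatten, List.map_replicate, List.sum_replicate, smul_eq_mul]
    nlinarith

/-- The number of occurrences of `y` in the derivation tree of `x`. -/
noncomputable def occ (G : WordGrammar α) (x y : List α) : ℕ :=
  (if x = y then 1 else 0) + ((G.ch x).attach.map fun c => occ G c.1 y).sum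
termination_by x.length
decreasing_by exact G.length_lt_of_mem_ch c.2

theorem occ_eq (x y : List α) :
    G.occ x y = (if x = y then 1 else 0) + ((G.ch x).map fun c => G.occ c y).sum := by
  rw [occ]
  congr 2
  exact List.attach_map_val (l := G.ch x) (f := fun c => G.occ c y)

theorem occ_self_pos (x : List α) : 0 < G.occ x x := by
  rw [occ_eq]; simp

theorem occ_eq_zero {x y : List α} (h : x.length < y.length) : G.occ x y = 0 := by
  induction hn : x.length using Nat.strong_induction_on generalizing x with
  | _ n ih =>
    subst hn
    rw [occ_eq, if_neg (by rintro rfl; simp at h), zero_add, List.sum_eq_zero]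
    intro k hk
    obtain ⟨c, hc, rfl⟩ := List.mem_map.mp hk
    have := G.length_lt_of_mem_ch hc
    exact ih _ this (by omega) rfl

/-- Distinct occurrences of `y` in the derivation tree of `x` are disjoint factors of `x`. -/
theorem occ_mul_length_le (x y : List α) : G.occ x y * y.length ≤ x.length := by
  induction hn : x.length using Nat.strong_induction_on generalizing x with
  | _ n ih =>
    subst hn
    rw [occ_eq]
    split_ifs with hxy
    · subst hxy
      rw [List.sum_eq_zero, add_zero, one_mul]
      intro k hk
      obtain ⟨c, hc, rfl⟩ := List.mem_map.mp hk
      exact G.occ_eq_zero (G.length_lt_of_mem_ch hc)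
    · rw [zero_add, ← List.sum_map_mul_right]
      refine (List.sum_le_sum fun c hc => ?_).trans (G.sum_length_ch_le x)
      exact ih _ (G.length_lt_of_mem_ch hc) _ rfl

/-- Every occurrence of a word `y` gives rise to as many occurrences of `v` as `v` occurs in the rule
of `y`, and these are distinct for distinct occurrences. -/
theorem sum_count_mul_occ_le (s : Finset (List α)) (x v : List α) :
    (if x = v then 1 else 0) + ∑ y ∈ s, (G.ch y).count v * G.occ x y ≤ G.occ x v := by
  induction hn : x.length using Nat.strong_induction_on generalizing x with
  | _ n ih =>
    subst hn
    have h1 : ∑ y ∈ s, (G.ch y).count v * G.occ x y ≤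
        (G.ch x).count v + ((G.ch x).map fun c => ∑ y ∈ s, (G.ch y).count v * G.occ c y).sum := by
      have h2 : ∀ y ∈ s, (G.ch y).count v * G.occ x y =
          (if x = y then (G.ch x).count v else 0) +
            ((G.ch x).map fun c => (G.ch y).count v * G.occ c y).sum := by
        intro y _
        rw [G.occ_eq x y, List.sum_map_mul_left, mul_add]
        split_ifs with h <;> simp [h]
      rw [Finset.sum_congr rfl h2, Finset.sum_add_distrib, Finset.sum_ite_eq]
      refine add_le_add (by split_ifs <;> simp) (le_of_eq ?_)
      induction G.ch x with
      | nil => simp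
      | cons a l ih => simp [Finset.sum_add_distrib, ih]
    have h3 : (G.ch x).count v + ((G.ch x).map fun c =>
        ∑ y ∈ s, (G.ch y).count v * G.occ c y).sum ≤ ((G.ch x).map fun c => G.occ c v).sum := by
      have h4 : (G.ch x).count v = ((G.ch x).map fun c => if c = v then 1 else 0).sum := by
        induction G.ch x with
        | nil => simp
        | cons a l ih => simp [List.count_cons, ih, add_comm]
      rw [h4, ← List.sum_map_add]
      exact List.sum_le_sum fun c hc => ih _ (G.length_lt_of_mem_ch hc) _ rfl
    rw [G.occ_eq x v]
    omega

theorem count_mul_occ_le (x y v : List α) : (G.ch y).count v * G.occ x y ≤ G.occ x v := by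
  have := G.sum_count_mul_occ_le {y} x v
  rw [Finset.sum_singleton] at this
  omega

theorem occ_le_of_mem_ch (x : List α) {y v : List α} (h : v ∈ G.ch y) :
    G.occ x y ≤ G.occ x v :=
  (Nat.le_mul_of_pos_left _ (List.count_pos_iff.mpr h)).trans (G.count_mul_occ_le x y v)

theorem occ_add_occ_le (x : List α) {y y' v : List α} (h : v ∈ G.ch y) (h' : v ∈ G.ch y')
    (hne : y ≠ y') : G.occ x y + G.occ x y' ≤ G.occ x v := by
  have h1 := G.sum_count_mul_occ_le {y, y'} x v
  rw [Finset.sum_pair hne] at h1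
  have h2 : G.occ x y ≤ (G.ch y).count v * G.occ x y :=
    Nat.le_mul_of_pos_left _ (List.count_pos_iff.mpr h)
  have h3 : G.occ x y' ≤ (G.ch y').count v * G.occ x y' :=
    Nat.le_mul_of_pos_left _ (List.count_pos_iff.mpr h')
  omega

end WordGrammar

namespace WordGrammar

open scoped Classical

variable {α : Type*} (G : WordGrammar α) (w : List α)

/-! ### Symmetric centroid paths -/

theorem log_lt_log_of_two_mul_le {a b : ℕ} (ha : 0 < a) (h : 2 * a ≤ b) :
    Nat.log 2 a < Nat.log 2 b := by
  calc Nat.log 2 a < Nat.log 2 (a * 2) := by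
        rw [Nat.log_mul_base (by norm_num) ha.ne']; omega
    _ ≤ _ := Nat.log_mono_right (by omega)

/-- The edge from `x` to `y` lies on a symmetric centroid path of the derivation of `w`: neither the
length of the derived word nor the number of occurrences in `w` changes its binary order of
magnitude. -/
def Link (x y : List α) : Prop :=
  x ∈ G.V ∧ 0 < G.occ w x ∧ y ∈ G.ch x ∧ Nat.log 2 x.length = Nat.log 2 y.length ∧
    Nat.log 2 (G.occ w x) = Nat.log 2 (G.occ w y)

variable {G w}

namespace Link

variable {x x' y y' : List α}

theorem length_lt (h : G.Link w x y) : y.length < x.length :=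
  G.length_lt_of_mem_ch h.2.2.1

theorem mem_right (h : G.Link w x y) : y ∈ G.V := G.mem _ h.1 _ h.2.2.1

theorem occ_le (h : G.Link w x y) : G.occ w x ≤ G.occ w y := G.occ_le_of_mem_ch w h.2.2.1

theorem length_le (h : G.Link w x y) : x.length ≤ w.length := by
  by_contra! hlt
  have := h.2.1
  rw [G.occ_eq_zero hlt] at this
  exact this.false

/-- A linked vertex has a binary rule, since the length drops by a factor `t > 2` along a run, and the
sibling is not linked, since the two lengths add up. -/
theorem exists_siblings (h : G.Link w x y) :
    ∃ l r : List α, x = l ++ y ++ r ∧ 0 < l.length + r.length ∧ (l = [] ∨ r = []) ∧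
      (∀ z ∈ G.ch x, z = y ∨ z = l ∨ z = r) ∧
      (l ≠ [] → l ∈ G.ch x ∧ ¬ G.Link w x l) ∧ (r ≠ [] → r ∈ G.ch x ∧ ¬ G.Link w x r) := by
  have hy : 0 < y.length := List.length_pos_of_ne_nil (G.ne_nil_of_mem_ch h.2.2.1)
  have hlog := h.2.2.2.1
  rcases G.shape x with h0 | ⟨u, v, hu, hv, h1, h2⟩ | ⟨u, t, hu, ht, h1, h2⟩
  · have := h.2.2.1
    simp [h0] at this
  · have hmem := h.2.2.1
    have hu' := List.length_pos_of_ne_nil hu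
    have hv' := List.length_pos_of_ne_nil hv
    have hlen : x.length = u.length + v.length := by simp [h2]
    rw [h1, List.mem_pair] at hmem
    have nolink : ¬ (Nat.log 2 x.length = Nat.log 2 u.length ∧
        Nat.log 2 x.length = Nat.log 2 v.length) := by
      rintro ⟨ha, hb⟩
      rcases le_total u.length v.length with h3 | h3
      · have := log_lt_log_of_two_mul_le (b := x.length) hu' (by omega)
        omega
      · have := log_lt_log_of_two_mul_le (b := x.length) hv' (by omega)
        omega
    rcases hmem with rfl | rfl
    · refine ⟨[], v, by simp [h2], by simpa using hv', by simp, by simp [h1], by simp, fun _ => ?_⟩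
      exact ⟨by simp [h1], fun h' => nolink ⟨hlog, h'.2.2.2.1⟩⟩
    · refine ⟨u, [], by simp [h2], by simpa using hu', by simp, by simp [h1],
        fun _ => ?_, by simp⟩
      exact ⟨by simp [h1], fun h' => nolink ⟨h'.2.2.2.1, hlog⟩⟩
  · have hmem := h.2.2.1
    rw [h1] at hmem
    obtain rfl := List.eq_of_mem_replicate hmem
    have hlen : x.length = t * y.length := by
      rw [h2]; simp
    have := log_lt_log_of_two_mul_le (b := x.length) hy (by rw [hlen]; gcongr)
    omega

theorem right_unique (h : G.Link w x y) (h' : G.Link w x y') : y = y' := by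
  obtain ⟨l, r, -, -, -, hall, hl, hr⟩ := h.exists_siblings
  have hy' := G.ne_nil_of_mem_ch h'.2.2.1
  rcases hall y' h'.2.2.1 with rfl | rfl | rfl
  · rfl
  · exact absurd h' (hl hy').2
  · exact absurd h' (hr hy').2

theorem left_unique (h : G.Link w x y) (h' : G.Link w x' y) : x = x' := by
  by_contra hne
  have h1 := G.occ_add_occ_le w h.2.2.1 h'.2.2.1 hne
  have h2 := h.2.2.2.2
  have h3 := h'.2.2.2.2
  rcases le_total (G.occ w x) (G.occ w x') with h4 | h4
  · have := log_lt_log_of_two_mul_le (b := G.occ w y) h.2.1 (by omega)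
    omega
  · have := log_lt_log_of_two_mul_le (b := G.occ w y) h'.2.1 (by omega)
    omega

end Link

variable (G w)

/-- The successor of `x` on its symmetric centroid path (junk at the end of a path). -/
noncomputable def next (x : List α) : List α :=
  if h : ∃ y, G.Link w x y then h.choose else []

variable {G w} in
theorem Link.next_eq {x y : List α} (h : G.Link w x y) : G.next w x = y := by
  have h' : ∃ y, G.Link w x y := ⟨y, h⟩
  rw [next, dif_pos h']
  exact h'.choose_spec.right_unique h

theorem link_next {x : List α} (h : ∃ y, G.Link w x y) : G.Link w x (G.next w x) := by
  rw [next, dif_pos h]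
  exact h.choose_spec

theorem exists_siblings_next (x : List α) : ∃ p : List α × List α, (∃ y, G.Link w x y) →
    x = p.1 ++ G.next w x ++ p.2 ∧ 0 < p.1.length + p.2.length ∧ (p.1 = [] ∨ p.2 = []) ∧
      (p.1 ≠ [] → p.1 ∈ G.ch x ∧ ¬ G.Link w x p.1) ∧
      (p.2 ≠ [] → p.2 ∈ G.ch x ∧ ¬ G.Link w x p.2) := by
  by_cases h : ∃ y, G.Link w x y
  · obtain ⟨l, r, h1, h2, h3, -, h4, h5⟩ := (G.link_next w h).exists_siblings
    exact ⟨(l, r), fun _ => ⟨h1, h2, h3, h4, h5⟩⟩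
  · exact ⟨([], []), fun h' => absurd h' h⟩

/-- The siblings to the left and to the right of the successor of `x` on its path; one of them is
empty. -/
noncomputable def siblings (x : List α) : List α × List α := (G.exists_siblings_next w x).choose

theorem siblings_spec {x : List α} (h : ∃ y, G.Link w x y) :
    x = (G.siblings w x).1 ++ G.next w x ++ (G.siblings w x).2 ∧
      0 < (G.siblings w x).1.length + (G.siblings w x).2.length ∧
      ((G.siblings w x).1 = [] ∨ (G.siblings w x).2 = []) ∧
      ((G.siblings w x).1 ≠ [] →
        (G.siblings w x).1 ∈ G.ch x ∧ ¬ G.Link w x (G.siblings w x).1) ∧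
      ((G.siblings w x).2 ≠ [] →
        (G.siblings w x).2 ∈ G.ch x ∧ ¬ G.Link w x (G.siblings w x).2) :=
  (G.exists_siblings_next w x).choose_spec h

/-- The total length of the siblings. -/
noncomputable def sibLength (x : List α) : ℕ :=
  (G.siblings w x).1.length + (G.siblings w x).2.length

/-- The vertices from `x` to the end of its path, without the end itself. -/
noncomputable def nodes (G : WordGrammar α) (w x : List α) : List (List α) :=
  if _h : ∃ y, G.Link w x y then x :: nodes G w (G.next w x) else []
termination_by x.length
decreasing_by exact (G.link_next w _h).length_lt

/-- The last vertex of the path through `x`. -/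
noncomputable def last (G : WordGrammar α) (w x : List α) : List α :=
  if _h : ∃ y, G.Link w x y then last G w (G.next w x) else x
termination_by x.length
decreasing_by exact (G.link_next w _h).length_lt

/-- The first vertex of the path through `x`. -/
noncomputable def top (G : WordGrammar α) (w x : List α) : List α :=
  if h : ∃ y, G.Link w y x then top G w h.choose else x
termination_by w.length - x.length
decreasing_by
  have h1 := h.choose_spec.length_lt
  have h2 := h.choose_spec.length_le
  omega

variable {G w} {x y : List α}

theorem Link.nodes_eq (h : G.Link w x y) : G.nodes w x = x :: G.nodes w y := by
  rw [nodes, dif_pos ⟨y, h⟩, h.next_eq]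

theorem Link.last_eq (h : G.Link w x y) : G.last w x = G.last w y := by
  rw [last, dif_pos ⟨y, h⟩, h.next_eq]

theorem Link.top_eq (h : G.Link w x y) : G.top w y = G.top w x := by
  have h' : ∃ x, G.Link w x y := ⟨x, h⟩
  rw [top, dif_pos h', h'.choose_spec.left_unique h]

theorem nodes_eq_nil (h : ¬ ∃ y, G.Link w x y) : G.nodes w x = [] := by
  rw [nodes, dif_neg h]

theorem last_eq_self (h : ¬ ∃ y, G.Link w x y) : G.last w x = x := by
  rw [last, dif_neg h]

variable (G w)

/-- Induction along a path, from its end. -/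
theorem path_induction {P : List α → Prop} (hend : ∀ x, (¬ ∃ y, G.Link w x y) → P x)
    (hlink : ∀ x y, G.Link w x y → P y → P x) (x : List α) : P x := by
  induction hn : x.length using Nat.strong_induction_on generalizing x with
  | _ n ih =>
    by_cases h : ∃ y, G.Link w x y
    · obtain ⟨y, hy⟩ := h
      exact hlink x y hy (ih _ (hn ▸ hy.length_lt) y rfl)
    · exact hend x h

/-- Induction along a path, from its beginning. -/
theorem path_induction_top {P : List α → Prop} (htop : ∀ x, (¬ ∃ y, G.Link w y x) → P x)
    (hlink : ∀ x y, G.Link w x y → P x → P y) (y : List α) : P y := by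
  induction hn : w.length - y.length using Nat.strong_induction_on generalizing y with
  | _ n ih =>
    by_cases h : ∃ x, G.Link w x y
    · obtain ⟨x, hx⟩ := h
      have h1 := hx.length_lt
      have h2 := hx.length_le
      exact hlink x y hx (ih _ (by omega) x rfl)
    · exact htop y h

theorem nodes_suffix_top (y : List α) :
    G.nodes w y <:+ G.nodes w (G.top w y) ∧ G.last w y = G.last w (G.top w y) := by
  induction y using G.path_induction_top w with
  | htop x h => rw [top, dif_neg h]; exact ⟨List.suffix_rfl, rfl⟩
  | hlink x y h ih =>
    rw [h.top_eq, ← ih.2, h.last_eq]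
    exact ⟨(h.nodes_eq ▸ List.suffix_cons _ _).trans ih.1, rfl⟩

theorem top_top (y : List α) : G.top w (G.top w y) = G.top w y := by
  induction y using G.path_induction_top w with
  | htop x h =>
    have h1 : G.top w x = x := by rw [top, dif_neg h]
    rw [h1, h1]
  | hlink x y h ih => rw [h.top_eq, ih]

theorem of_mem_nodes {x z : List α} (hz : z ∈ G.nodes w x) :
    (∃ y, G.Link w z y) ∧ G.top w z = G.top w x ∧ z.length ≤ x.length ∧
      Nat.log 2 z.length = Nat.log 2 x.length ∧
      Nat.log 2 (G.occ w z) = Nat.log 2 (G.occ w x) := by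
  induction x using G.path_induction w with
  | hend x h => simp [nodes_eq_nil h] at hz
  | hlink x y h ih =>
    rw [h.nodes_eq, List.mem_cons] at hz
    rcases hz with rfl | hz
    · exact ⟨⟨y, h⟩, rfl, le_rfl, rfl, rfl⟩
    · obtain ⟨h1, h2, h3, h4, h5⟩ := ih hz
      exact ⟨h1, h2.trans h.top_eq, h3.trans h.length_lt.le, h4.trans h.2.2.2.1.symm,
        h5.trans h.2.2.2.2.symm⟩

theorem log_last (x : List α) : Nat.log 2 (G.last w x).length = Nat.log 2 x.length ∧
    Nat.log 2 (G.occ w (G.last w x)) = Nat.log 2 (G.occ w x) := by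
  induction x using G.path_induction w with
  | hend x h => rw [last_eq_self h]; exact ⟨rfl, rfl⟩
  | hlink x y h ih =>
    rw [h.last_eq]
    exact ⟨ih.1.trans h.2.2.2.1.symm, ih.2.trans h.2.2.2.2.symm⟩

theorem last_no_link (x : List α) : ¬ ∃ y, G.Link w (G.last w x) y := by
  induction x using G.path_induction w with
  | hend x h => rwa [last_eq_self h]
  | hlink x y h ih => rwa [h.last_eq]

theorem last_mem (x : List α) (hx : x ∈ G.V) (hocc : 0 < G.occ w x) :
    G.last w x ∈ G.V ∧ 0 < G.occ w (G.last w x) := by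
  induction x using G.path_induction w with
  | hend x h => rw [last_eq_self h]; exact ⟨hx, hocc⟩
  | hlink x y h ih =>
    rw [h.last_eq]
    exact ih h.mem_right (hocc.trans_le h.occ_le)

theorem top_mem (x : List α) (hx : x ∈ G.V) (hocc : 0 < G.occ w x) :
    G.top w x ∈ G.V ∧ 0 < G.occ w (G.top w x) := by
  induction x using G.path_induction_top w with
  | htop x h => rw [top, dif_neg h]; exact ⟨hx, hocc⟩
  | hlink x y h ih =>
    rw [h.top_eq]
    exact ih h.1 h.2.1

theorem log_top (x : List α) : Nat.log 2 (G.top w x).length = Nat.log 2 x.length ∧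
    Nat.log 2 (G.occ w (G.top w x)) = Nat.log 2 (G.occ w x) := by
  have h1 := G.log_last w x
  have h2 := G.log_last w (G.top w x)
  rw [(G.nodes_suffix_top w x).2] at h1
  exact ⟨h2.1.symm.trans h1.1, h2.2.symm.trans h1.2⟩

theorem nodup_nodes (x : List α) : (G.nodes w x).Nodup := by
  induction x using G.path_induction w with
  | hend x h => simp [nodes_eq_nil h]
  | hlink x y h ih =>
    rw [h.nodes_eq, List.nodup_cons]
    refine ⟨fun hmem => ?_, ih⟩
    have h1 := (G.of_mem_nodes w hmem).2.2.1
    have h2 := h.length_lt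
    omega

theorem wrap_nodes (x : List α) :
    wrap (fun z => (G.siblings w z).1) (fun z => (G.siblings w z).2) (G.nodes w x)
      (G.last w x) = x := by
  induction x using G.path_induction w with
  | hend x h => rw [nodes_eq_nil h, last_eq_self h]; rfl
  | hlink x y h ih =>
    rw [h.nodes_eq, h.last_eq, wrap_cons, ih]
    conv_rhs => rw [(G.siblings_spec w ⟨y, h⟩).1, h.next_eq]

theorem sum_sibLength_nodes (x : List α) :
    ((G.nodes w x).map (G.sibLength w)).sum + (G.last w x).length = x.length := by
  induction x using G.path_induction w with
  | hend x h => simp [nodes_eq_nil h, last_eq_self h]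
  | hlink x y h ih =>
    have h1 := congrArg List.length (G.siblings_spec w ⟨y, h⟩).1
    rw [h.next_eq] at h1
    simp only [List.length_append] at h1
    rw [h.nodes_eq, h.last_eq, List.map_cons, List.sum_cons, sibLength]
    omega

/-- The number of occurrences of `x` in the derivation of `w` that are not reached along the path
through `x`. -/
noncomputable def ext (x : List α) : ℕ :=
  G.occ w x - if h : ∃ y, G.Link w y x then G.occ w h.choose else 0

variable {G w} in
theorem Link.ext_add {x y : List α} (h : G.Link w x y) :
    G.ext w y + G.occ w x = G.occ w y := by
  have h' : ∃ x, G.Link w x y := ⟨x, h⟩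
  rw [ext, dif_pos h', h'.choose_spec.left_unique h]
  have := h.occ_le
  omega

theorem ext_le (x : List α) : G.ext w x ≤ G.occ w x := Nat.sub_le _ _

theorem ext_self_pos : 0 < G.ext w w := by
  have h : ¬ ∃ y, G.Link w y w := by
    rintro ⟨y, hy⟩
    exact (hy.length_le.trans_lt hy.length_lt).false
  rw [ext, dif_neg h]
  exact G.occ_self_pos w

variable {G w} in
theorem le_ext_of_not_link {x y : List α} (hy : y ∈ G.ch x) (h : ¬ G.Link w x y) :
    G.occ w x ≤ G.ext w y := by
  rw [ext]
  split_ifs with h'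
  · have h1 := h'.choose_spec
    have hne : h'.choose ≠ x := fun he => h (he ▸ h1)
    have := G.occ_add_occ_le w h1.2.2.1 hy hne
    omega
  · exact G.occ_le_of_mem_ch w hy

/-- The numbers of external occurrences along a path add up. -/
theorem sum_ext_nodes (x : List α) :
    ((G.nodes w x).map (G.ext w)).sum + G.occ w x ≤ G.occ w (G.last w x) + G.ext w x := by
  induction x using G.path_induction w with
  | hend x h => simp [nodes_eq_nil h, last_eq_self h]
  | hlink x y h ih =>
    have := h.ext_add
    rw [h.nodes_eq, h.last_eq, List.map_cons, List.sum_cons]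
    omega

theorem sum_length_nodes_le :
    ∑ t ∈ G.V.image (G.top w), (G.nodes w t).length ≤ G.V.card := by
  rw [Finset.card_eq_sum_card_image (G.top w) G.V]
  refine Finset.sum_le_sum fun t ht => ?_
  rw [← List.toFinset_card_of_nodup (G.nodup_nodes w t)]
  refine Finset.card_le_card fun z hz => ?_
  obtain ⟨y, -, rfl⟩ := Finset.mem_image.mp ht
  obtain ⟨⟨y', h1⟩, h2, -⟩ := G.of_mem_nodes w (List.mem_toFinset.mp hz)
  exact Finset.mem_filter.mpr ⟨h1.1, by rw [h2, top_top]⟩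

end WordGrammar

namespace WordGrammar

open scoped Classical

variable {α : Type*} (G : WordGrammar α) (w : List α)

/-! ### The balanced derivation -/

/-- The level of a word: it decreases along every edge that is not on a symmetric centroid path, and
is constant along the paths. -/
noncomputable def level (x : List α) : ℕ :=
  (Nat.log 2 w.length - Nat.log 2 (G.occ w x)) + Nat.log 2 x.length

theorem log_occ_le {x : List α} (hx : x ≠ []) :
    Nat.log 2 (G.occ w x) ≤ Nat.log 2 w.length := by
  refine Nat.log_mono_right ((Nat.le_mul_of_pos_right _ ?_).trans (G.occ_mul_length_le w x))
  exact List.length_pos_of_ne_nil hx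

variable {G w} in
theorem level_lt {x y : List α} (hx : x ∈ G.V) (hocc : 0 < G.occ w x) (hy : y ∈ G.ch x)
    (h : ¬ G.Link w x y) : G.level w y < G.level w x := by
  have h1 : Nat.log 2 y.length ≤ Nat.log 2 x.length :=
    Nat.log_mono_right (G.length_lt_of_mem_ch hy).le
  have h2 : Nat.log 2 (G.occ w x) ≤ Nat.log 2 (G.occ w y) :=
    Nat.log_mono_right (G.occ_le_of_mem_ch w hy)
  have h3 := G.log_occ_le w (G.ne_nil_of_mem_ch hy)
  have h4 : ¬ (Nat.log 2 x.length = Nat.log 2 y.length ∧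
      Nat.log 2 (G.occ w x) = Nat.log 2 (G.occ w y)) := fun h' => h ⟨hx, hocc, hy, h'⟩
  rw [level, level]
  omega

/-- The weight of a vertex `z` on the path that begins in `t`. It is large if a large sibling hangs off
the path in `z`, and also if the path is often entered in `z`: the distance from the entry to the exit
of a path then telescopes in the lengths of the words and in their numbers of occurrences. -/
noncomputable def weight (t z : List α) : ℕ :=
  G.sibLength w z * 2 ^ Nat.log 2 (G.occ w t) + G.ext w z * 2 ^ Nat.log 2 t.length

theorem log_sum_weight_le (t : List α) :
    Nat.log 2 ((G.nodes w t).map (G.weight w t)).sum ≤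
      Nat.log 2 t.length + Nat.log 2 (G.occ w t) + 1 := by
  have h1 : ((G.nodes w t).map (G.weight w t)).sum =
      ((G.nodes w t).map (G.sibLength w)).sum * 2 ^ Nat.log 2 (G.occ w t) +
        ((G.nodes w t).map (G.ext w)).sum * 2 ^ Nat.log 2 t.length := by
    rw [← List.sum_map_mul_right, ← List.sum_map_mul_right, ← List.sum_map_add]
    rfl
  have h2 : ((G.nodes w t).map (G.sibLength w)).sum < 2 ^ (Nat.log 2 t.length + 1) := by
    have h3 := G.sum_sibLength_nodes w t
    exact (Nat.le.intro h3).trans_lt (Nat.lt_pow_succ_log_self (by norm_num) _)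
  have h4 : ((G.nodes w t).map (G.ext w)).sum < 2 ^ (Nat.log 2 (G.occ w t) + 1) := by
    have h5 := G.sum_ext_nodes w t
    have h6 := G.ext_le w t
    rw [← (G.log_last w t).2]
    exact (show _ ≤ G.occ w (G.last w t) by omega).trans_lt
      (Nat.lt_pow_succ_log_self (by norm_num) _)
  refine Nat.lt_succ_iff.mp (Nat.log_lt_of_lt_pow' (by omega) ?_)
  rw [h1]
  calc _ < 2 ^ (Nat.log 2 t.length + 1) * 2 ^ Nat.log 2 (G.occ w t) +
        2 ^ (Nat.log 2 (G.occ w t) + 1) * 2 ^ Nat.log 2 t.length := by gcongr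
    _ = _ := by rw [Nat.succ_eq_add_one]; ring

theorem le_log_of_mul_two_pow_le {a k m : ℕ} (ha : 0 < a) (h : a * 2 ^ k ≤ m) :
    Nat.log 2 a + k ≤ Nat.log 2 m := by
  have h1 := Nat.pow_log_le_self 2 ha.ne'
  refine Nat.le_log_of_pow_le (by norm_num) ?_
  rw [pow_add]
  exact (Nat.mul_le_mul_right _ h1).trans h

/-- Every word that is derived by a word grammar has a balanced derivation with linearly many words. -/
theorem exists_balanced (hw : w ∈ G.V) : ∃ W : Finset (List α), W.card ≤ 9 * G.V.card ∧
    Der W w (36 * Nat.log 2 w.length) := by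
  have hctx := fun t => exists_contexts (fun z => (G.siblings w z).1)
    (fun z => (G.siblings w z).2) (G.weight w t) _ (G.nodes w t) (G.last w t) le_rfl (by
      intro z hz
      have h1 := (G.siblings_spec w (G.of_mem_nodes w hz).1).2.1
      have h2 : 0 < G.sibLength w z * 2 ^ Nat.log 2 (G.occ w t) := by
        rw [sibLength]; positivity
      rw [weight]
      omega)
  choose S hcard hS using hctx
  set W := G.V ∪ (G.V.image (G.top w)).biUnion S with hW
  refine ⟨W, ?_, ?_⟩
  · have h1 := Finset.card_union_le G.V ((G.V.image (G.top w)).biUnion S)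
    have h2 : ((G.V.image (G.top w)).biUnion S).card ≤
        ∑ t ∈ G.V.image (G.top w), 8 * (G.nodes w t).length :=
      Finset.card_biUnion_le.trans (Finset.sum_le_sum fun t _ => hcard t)
    rw [← Finset.mul_sum] at h2
    have h3 := G.sum_length_nodes_le w
    rw [← hW] at h1
    omega
  have hVW : G.V ⊆ W := Finset.subset_union_left
  have main : ∀ m x, x ∈ G.V → 0 < G.occ w x → 0 < G.ext w x → G.level w x = m →
      Der W x (4 * (Nat.log 2 x.length + (Nat.log 2 w.length - Nat.log 2 (G.ext w x))) +
        14 * m) := by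
    intro m
    induction m using Nat.strong_induction_on with
    | _ m ih =>
    intro x hx hocc hext hm
    by_cases hch : G.ch x = []
    · obtain ⟨a, rfl⟩ := G.leaf x hx hch
      exact .leaf (hVW hx)
    obtain ⟨c, hc⟩ := List.exists_mem_of_ne_nil _ hch
    have hlen : 2 ≤ x.length := by
      have h1 := G.length_lt_of_mem_ch hc
      have h2 := List.length_pos_of_ne_nil (G.ne_nil_of_mem_ch hc)
      omega
    have hne : x ≠ [] := by rintro rfl; simp at hlen
    have hr1 : 1 ≤ Nat.log 2 x.length := Nat.log_pos (by norm_num) hlen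
    have hext' : Nat.log 2 (G.ext w x) ≤ Nat.log 2 (G.occ w x) :=
      Nat.log_mono_right (G.ext_le w x)
    have hsN := G.log_occ_le w hne
    clear hc hch c
    set t := G.top w x with ht
    obtain ⟨htV, htocc⟩ := G.top_mem w x hx hocc
    obtain ⟨hlen_t, hocc_t⟩ := G.log_top w x
    rw [← ht] at htV htocc hlen_t hocc_t
    set r := Nat.log 2 x.length with hr
    set s := Nat.log 2 (G.occ w x) with hs
    set N := Nat.log 2 w.length with hN
    have hm' : m = N - s + r := hm.symm
    -- vertices that hang off the path have a smaller level
    have child : ∀ z c, z ∈ G.V → 0 < G.occ w z → Nat.log 2 z.length = r →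
        Nat.log 2 (G.occ w z) = s → c ∈ G.ch z → ¬ G.Link w z c →
        Der W c (4 * (Nat.log 2 c.length + (N - s)) + 14 * (m - 1)) ∧ 1 ≤ m := by
      intro z c hz hzocc hzr hzs hc hlink
      have h1 := level_lt hz hzocc hc hlink
      have h2 : G.level w z = m := by rw [level, hzr, hzs, hm']
      have h3 := le_ext_of_not_link hc hlink
      have h4 : s ≤ Nat.log 2 (G.ext w c) := hzs ▸ Nat.log_mono_right h3
      exact ⟨(ih _ (h2 ▸ h1) c (G.mem _ hz _ hc) (hzocc.trans_le (G.occ_le_of_mem_ch w hc))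
        (hzocc.trans_le h3) rfl).mono (by omega), by omega⟩
    set d := 4 * (r + 1 + (N - s)) + 14 * (m - 1) with hd
    have hlastmem := G.last_mem w x hx hocc
    have hlastlog := G.log_last w x
    have hlastno := G.last_no_link w x
    have hlast : Der W (G.last w x) d := by
      have hc : ∀ c ∈ G.ch (G.last w x), Der W c
          (4 * (Nat.log 2 c.length + (N - s)) + 14 * (m - 1)) ∧ 1 ≤ m := fun c hc =>
        child _ c hlastmem.1 hlastmem.2 hlastlog.1 hlastlog.2 hc fun hl => hlastno ⟨c, hl⟩
      have hlog : ∀ c ∈ G.ch (G.last w x), Nat.log 2 c.length ≤ r := fun c hc => by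
        rw [hr, ← hlastlog.1]
        exact Nat.log_mono_right (G.length_lt_of_mem_ch hc).le
      rcases G.shape (G.last w x) with h0 | ⟨u, v, hu, hv, h1, h2⟩ | ⟨u, k, hu, hk, h1, h2⟩
      · obtain ⟨a, ha⟩ := G.leaf _ hlastmem.1 h0
        rw [ha]
        exact .leaf (ha ▸ hVW hlastmem.1)
      · have hcu := hlog u (by simp [h1])
        have hcv := hlog v (by simp [h1])
        rw [h2]
        exact .cat (d := d - 1) ((hc u (by simp [h1])).1.mono (by omega))
          ((hc v (by simp [h1])).1.mono (by omega)) (by omega) (h2 ▸ hVW hlastmem.1)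
      · have hmem : u ∈ G.ch (G.last w x) := by simp [h1]; omega
        have hlogk : Nat.log 2 u.length + Nat.log 2 k ≤ r := by
          have h3 : (G.last w x).length = u.length * k := by rw [h2]; simp [mul_comm]
          have h4 := le_log_of_mul_two_pow_le (a := u.length) (k := Nat.log 2 k)
            (m := (G.last w x).length) (List.length_pos_of_ne_nil hu) (by
              rw [h3]; exact Nat.mul_le_mul_left _ (Nat.pow_log_le_self 2 (by omega)))
          rw [hr, ← hlastlog.1]
          exact h4
        rw [h2]
        exact .run (d := d - 1 - Nat.log 2 k) ((hc u hmem).1.mono (by omega)) hk (by omega)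
          (h2 ▸ hVW hlastmem.1)
    by_cases hlink : ∃ y, G.Link w x y
    · obtain ⟨y, hy⟩ := hlink
      have hSW : S t ⊆ W := fun z hz => Finset.mem_union_right _
        (Finset.mem_biUnion.mpr ⟨t, Finset.mem_image_of_mem _ hx, hz⟩)
      have hQ := G.log_sum_weight_le w t
      rw [hlen_t, hocc_t] at hQ
      obtain ⟨hsuf, hlasteq⟩ := G.nodes_suffix_top w x
      rw [← ht] at hsuf hlasteq
      have hres := (hS t W hSW
        (fun z => 4 * (Nat.log 2 (G.sibLength w z) + (N - s)) + 14 * (m - 1)) d ?_).2.2 (d + 2)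
        le_rfl (hlasteq ▸ Or.inr (hlast.mono (by omega))) x (G.nodes w y)
        (hy.nodes_eq ▸ hsuf)
      · rw [← hy.nodes_eq, ← hlasteq, wrap_nodes] at hres
        refine (hres.resolve_left hne).mono ?_
        have hq : Nat.log 2 (G.ext w x) + r ≤ Nat.log 2 (G.weight w t x) :=
          le_log_of_mul_two_pow_le hext (by rw [weight, hlen_t]; exact Nat.le_add_left _ _)
        omega
      · intro z hz
        obtain ⟨⟨z', hz'⟩, -, -, hzlen, hzocc⟩ := G.of_mem_nodes w hz
        obtain ⟨-, hpos, hor, hl, hr'⟩ := G.siblings_spec w ⟨z', hz'⟩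
        rw [hlen_t] at hzlen
        rw [hocc_t] at hzocc
        have hq : Nat.log 2 (G.sibLength w z) + s ≤ Nat.log 2 (G.weight w t z) :=
          le_log_of_mul_two_pow_le hpos (by rw [weight, hocc_t]; exact Nat.le_add_right _ _)
        have hsib : Nat.log 2 (G.sibLength w z) ≤ r := by
          have := G.sum_sibLength_nodes w z
          rw [hz'.nodes_eq, List.map_cons, List.sum_cons] at this
          exact hzlen ▸ Nat.log_mono_right (by omega)
        refine ⟨?_, ?_, by omega⟩
        · by_cases h0 : (G.siblings w z).1 = []
          · exact Or.inl h0
          · have h1 := (child z _ hz'.1 hz'.2.1 hzlen hzocc (hl h0).1 (hl h0).2).1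
            refine Or.inr (h1.mono ?_)
            have : Nat.log 2 (G.siblings w z).1.length ≤ Nat.log 2 (G.sibLength w z) :=
              Nat.log_mono_right (Nat.le_add_right _ _)
            omega
        · by_cases h0 : (G.siblings w z).2 = []
          · exact Or.inl h0
          · have h1 := (child z _ hz'.1 hz'.2.1 hzlen hzocc (hr' h0).1 (hr' h0).2).1
            refine Or.inr (h1.mono ?_)
            have : Nat.log 2 (G.siblings w z).2.length ≤ Nat.log 2 (G.sibLength w z) :=
              Nat.log_mono_right (Nat.le_add_left _ _)
            omega
    · rw [last_eq_self hlink] at hlast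
      refine hlast.mono ?_
      omega
  have hroot := main _ w hw (G.occ_self_pos w) (G.ext_self_pos w) rfl
  refine hroot.mono ?_
  have : G.level w w ≤ 2 * Nat.log 2 w.length := by rw [level]; omega
  omega

end WordGrammar

/-! ### From run-length straight-line programs to sets of words -/

namespace WordGrammar

/-- A finite set of words in which every word is a terminal symbol, a concatenation of two words of the
set, or a run of a word of the set, is the set of variables of a word grammar. -/
theorem exists_of_closed {α : Type*} (V : Finset (List α))
    (hV : ∀ x ∈ V, (∃ a, x = [a]) ∨ (∃ u ∈ V, ∃ v ∈ V, u ≠ [] ∧ v ≠ [] ∧ x = u ++ v) ∨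
      ∃ u ∈ V, ∃ t, u ≠ [] ∧ 2 < t ∧ x = (List.replicate t u).flatten) :
    ∃ K : WordGrammar α, K.V = V := by
  classical
  have h : ∀ x, ∃ c : List (List α), (c = [] ∨
      (∃ u v, u ≠ [] ∧ v ≠ [] ∧ c = [u, v] ∧ x = u ++ v) ∨
      (∃ u t, u ≠ [] ∧ 2 < t ∧ c = List.replicate t u ∧ x = (List.replicate t u).flatten)) ∧
      (x ∈ V → (∀ z ∈ c, z ∈ V) ∧ (c = [] → ∃ a, x = [a])) := by
    intro x
    by_cases hx : x ∈ V
    · rcases hV x hx with ha | ⟨u, hu, v, hv, hu0, hv0, rfl⟩ | ⟨u, hu, t, hu0, ht, rfl⟩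
      · exact ⟨[], Or.inl rfl, fun _ => ⟨by simp, fun _ => ha⟩⟩
      · exact ⟨[u, v], Or.inr (Or.inl ⟨u, v, hu0, hv0, rfl, rfl⟩),
          fun _ => ⟨by simp [hu, hv], by simp⟩⟩
      · refine ⟨List.replicate t u, Or.inr (Or.inr ⟨u, t, hu0, ht, rfl, rfl⟩),
          fun _ => ⟨fun z hz => List.eq_of_mem_replicate hz ▸ hu, fun h => ?_⟩⟩
        rw [List.replicate_eq_nil_iff] at h
        omega
    · exact ⟨[], Or.inl rfl, fun h => absurd h hx⟩
  choose ch hch using h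
  exact ⟨⟨V, ch, fun x => (hch x).1, fun x hx => ((hch x).2 hx).1,
    fun x hx => ((hch x).2 hx).2⟩, rfl⟩

end WordGrammar

namespace RLSLP

variable {α : Type*} (G : RLSLP α) {A : Fin (G.start + 1)}

/-- A variable on the right-hand side of the rule of `A`, as a variable of the program. -/
abbrev lower (A : Fin (G.start + 1)) (B : Fin A) : Fin (G.start + 1) :=
  ⟨B, B.isLt.trans A.isLt⟩

variable {G}

theorem exp_of_term {a : α} (h : G.rule A = .term a) : G.exp A = [a] := by
  rw [exp, h]

theorem exp_of_concat {rhs : List (Fin A)} {hk : 1 < rhs.length}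
    (h : G.rule A = .concat rhs hk) : G.exp A = rhs.flatMap fun B => G.exp (G.lower A B) := by
  rw [exp, h]

theorem exp_of_run {B : Fin A} {t : ℕ} {ht : 2 < t} (h : G.rule A = .run B t ht) :
    G.exp A = (List.replicate t (G.exp (G.lower A B))).flatten := by
  rw [exp, h]

variable (G)

theorem exp_ne_nil (A : Fin (G.start + 1)) : G.exp A ≠ [] := by
  induction hn : A.val using Nat.strong_induction_on generalizing A with
  | _ n ih =>
  rcases h : G.rule A with a | ⟨rhs, hk⟩ | ⟨B, t, ht⟩
  · simp [exp_of_term h]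
  · rcases rhs with _ | ⟨B, rhs⟩
    · simp at hk
    · have := ih B (hn ▸ B.isLt) (G.lower A B) rfl
      simp [exp_of_concat h, this]
  · have h1 := ih B (hn ▸ B.isLt) (G.lower A B) rfl
    obtain ⟨t, rfl⟩ : ∃ k, t = k + 1 := ⟨t - 1, by omega⟩
    simp [exp_of_run h, List.replicate_succ, h1]

open scoped Classical in
/-- The words that a rule contributes when it is split into binary concatenations: the suffixes of a
right-hand side. -/
noncomputable def words (A : Fin (G.start + 1)) : Finset (List α) :=
  match G.rule A with
  | .concat rhs _ => (Finset.range rhs.length).image fun m =>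
      (rhs.drop m).flatMap fun B => G.exp (G.lower A B)
  | _ => {G.exp A}

theorem exp_mem_words (A : Fin (G.start + 1)) : G.exp A ∈ G.words A := by
  rw [words]
  split
  · next rhs hk h =>
    classical
    exact Finset.mem_image.mpr ⟨0, by simp; omega, by rw [exp_of_concat h, List.drop_zero]⟩
  · simp

theorem card_words_le (A : Fin (G.start + 1)) : (G.words A).card ≤ (G.rule A).size := by
  classical
  rw [words]
  rcases h : G.rule A with a | ⟨rhs, hk⟩ | ⟨B, t, ht⟩
  · simp [RLRule.size]
  · simpa [RLRule.size] using Finset.card_image_le (s := Finset.range rhs.length)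
  · simp [RLRule.size]

theorem exists_wordGrammar : ∃ K : WordGrammar α, G.word ∈ K.V ∧ K.V.card ≤ G.size := by
  classical
  set V := Finset.univ.biUnion G.words with hVdef
  have hmem : ∀ A, ∀ x ∈ G.words A, x ∈ V := fun A x hx =>
    Finset.mem_biUnion.mpr ⟨A, Finset.mem_univ _, hx⟩
  have hexp : ∀ A, G.exp A ∈ V := fun A => hmem A _ (G.exp_mem_words A)
  have hV : ∀ n, ∀ A : Fin (G.start + 1), A.val = n → ∀ x ∈ G.words A,
      (∃ a, x = [a]) ∨ (∃ u ∈ V, ∃ v ∈ V, u ≠ [] ∧ v ≠ [] ∧ x = u ++ v) ∨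
      ∃ u ∈ V, ∃ t, u ≠ [] ∧ 2 < t ∧ x = (List.replicate t u).flatten := by
    intro n
    induction n using Nat.strong_induction_on with
    | _ n ih =>
    intro A hA x hx
    have hx' := hx
    rw [words] at hx
    rcases h : G.rule A with a | ⟨rhs, hk⟩ | ⟨B, t, ht⟩
    · simp only [h, Finset.mem_singleton] at hx
      exact Or.inl ⟨a, hx.trans (exp_of_term h)⟩
    · simp only [h, Finset.mem_image, Finset.mem_range] at hx
      obtain ⟨m, hm, rfl⟩ := hx
      rcases Nat.lt_or_ge (m + 1) rhs.length with hm1 | hm1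
      · refine Or.inr (Or.inl ⟨_, hexp (G.lower A rhs[m]), _, hmem A
          ((rhs.drop (m + 1)).flatMap fun B => G.exp (G.lower A B)) ?_, G.exp_ne_nil _, ?_, ?_⟩)
        · rw [words]
          simp only [h, Finset.mem_image, Finset.mem_range]
          exact ⟨m + 1, hm1, rfl⟩
        · simpa [G.exp_ne_nil] using
            List.exists_mem_of_ne_nil _ (List.drop_eq_nil_iff.not.mpr hm1.not_ge)
        · rw [List.drop_eq_getElem_cons hm, List.flatMap_cons]
      · -- the last suffix is the word of a smaller variable
        have hlast : (rhs.drop m).flatMap (fun B => G.exp (G.lower A B)) =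
            G.exp (G.lower A rhs[m]) := by
          rw [List.drop_eq_getElem_cons hm, List.drop_eq_nil_of_le hm1]
          simp
        rw [hlast]
        exact ih _ (rhs[m].isLt.trans_eq hA) (G.lower A rhs[m]) rfl _ (G.exp_mem_words _)
    · simp only [h, Finset.mem_singleton] at hx
      exact Or.inr (Or.inr ⟨_, hexp (G.lower A B), t, G.exp_ne_nil _, ht,
        hx.trans (exp_of_run h)⟩)
  obtain ⟨K, hK⟩ := WordGrammar.exists_of_closed V fun x hx => by
    obtain ⟨A, -, hA⟩ := Finset.mem_biUnion.mp hx
    exact hV _ A rfl x hA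
  refine ⟨K, hK ▸ hexp _, ?_⟩
  rw [hK, size]
  exact Finset.card_biUnion_le.trans (Finset.sum_le_sum fun A _ => G.card_words_le A)

/-- The RLSLP with one variable per position of `w` and one rule of length `|w|`. -/
def trivial (w : List α) (hw : 2 ≤ w.length) : RLSLP α where
  start := w.length
  rule A := if h : A.val < w.length then .term w[A.val]
    else .concat (List.finRange A.val) (by simp; omega)

theorem word_trivial (w : List α) (hw : 2 ≤ w.length) : (trivial w hw).word = w := by
  have h1 : ∀ A : Fin (w.length + 1), (h : A.val < w.length) →
      (trivial w hw).exp A = [w[A.val]] := fun A h => exp_of_term (by simp [trivial, h])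
  have h2 : (trivial w hw).rule (Fin.last w.length) =
      .concat (List.finRange w.length) (by simp; omega) := by
    simp [trivial]
  rw [word]
  refine (exp_of_concat h2).trans ?_
  have h3 : ∀ B : Fin w.length,
      (trivial w hw).exp ((trivial w hw).lower (Fin.last w.length) B) = [w[B.val]] :=
    fun B => h1 _ B.isLt
  refine (List.flatMap_congr fun B _ => h3 B).trans ?_
  rw [← List.map_eq_flatMap]
  exact by simp

theorem size_trivial (w : List α) (hw : 2 ≤ w.length) :
    (trivial w hw).size = 2 * w.length := by
  rw [size]
  refine (Fin.sum_univ_castSucc (n := w.length) _).trans ?_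
  simp [trivial, RLRule.size]
  omega

end RLSLP

theorem gRl_le_two_mul_length {α : Type*} (w : List α) (hw : 2 ≤ w.length) :
    gRl w ≤ 2 * w.length :=
  Nat.sInf_le ⟨_, RLSLP.word_trivial w hw, RLSLP.size_trivial w hw⟩

/-- The balancing theorem for run-length straight-line programs. -/
theorem exists_balanced_derivation {α : Type*} (w : List α) (hw : 2 ≤ w.length) :
    ∃ W : Finset (List α), W.card ≤ 9 * gRl w ∧ Der W w (36 * Nat.log 2 w.length) := by
  obtain ⟨G, hG, hsize⟩ : gRl w ∈ {m | ∃ G : RLSLP α, G.word = w ∧ G.size = m} :=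
    Nat.sInf_mem ⟨_, _, RLSLP.word_trivial w hw, rfl⟩
  obtain ⟨K, hK, hcard⟩ := G.exists_wordGrammar
  obtain ⟨W, hW, hder⟩ := K.exists_balanced w (hG ▸ hK)
  exact ⟨W, hW.trans (by omega), hder⟩

/-! ### A program logic for the word RAM -/

namespace WordRAM

/-- An upper bound for the registers that a program writes to. -/
def Prog.bound : Prog → ℕ
  | .skip => 0
  | .const r _ => r + 1
  | .move r _ => r + 1
  | .op _ r _ _ => r + 1
  | .read r _ => r + 1
  | .load r _ => r + 1
  | .store _ _ => 0
  | .seq P Q => max P.bound Q.bound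
  | .ite _ P Q => max P.bound Q.bound
  | .loop _ P => P.bound

variable {b : ℕ} {D : List (BitVec b)} {s : ℕ}

theorem Exec.reg_eq_of_bound_le {P : Prog} {σ σ' : State b} {t : ℕ} (h : Exec D s P σ t σ') (r : ℕ)
    (hr : P.bound ≤ r) : σ'.reg r = σ.reg r := by
  induction h with
  | skip | store | loop_false => rfl
  | const σ r' k | move σ r' x | op σ o r' x y | read σ r' a h | load σ r' a h =>
    simp only [Prog.bound] at hr
    simp only [State.setReg]
    exact Function.update_of_ne (by omega) _ _
  | seq h₁ h₂ ih₁ ih₂ =>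
    rw [Prog.bound, max_le_iff] at hr
    rw [ih₂ hr.2, ih₁ hr.1]
  | ite_true hc h ih =>
    rw [Prog.bound, max_le_iff] at hr
    exact ih hr.1
  | ite_false hc h ih =>
    rw [Prog.bound, max_le_iff] at hr
    exact ih hr.2
  | loop_true hc h₁ h₂ ih₁ ih₂ => rw [ih₂ hr, ih₁ hr]

theorem Exec.steps_pos {P : Prog} {σ σ' : State b} {t : ℕ} (h : Exec D s P σ t σ') : 0 < t := by
  induction h <;> omega

/-- The registers from `M` on hold the numbers `ρ 0, ρ 1, …`. -/
def Holds (M : ℕ) (σ : State b) (ρ : ℕ → ℕ) : Prop :=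
  ∀ i, σ.reg (M + i) = BitVec.ofNat b (ρ i)

/-- Total correctness with a time bound, for programs that keep their own data in the registers from
`M` on: started with the numbers `ρ` in these registers and arbitrary other contents, the program
halts within `t` steps, with numbers in these registers that satisfy `Post`. The registers below `M`
and the working memory are left to subroutines. -/
def Spec (D : List (BitVec b)) (s M : ℕ) (P : Prog) (t : ℕ) (ρ : ℕ → ℕ)
    (Post : (ℕ → ℕ) → Prop) : Prop :=
  ∀ σ : State b, Holds M σ ρ → ∃ t' ≤ t, ∃ σ' ρ', Exec D s P σ t' σ' ∧ Holds M σ' ρ' ∧ Post ρ'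

namespace Spec

variable {M : ℕ} {P Q : Prog} {t t₁ t₂ : ℕ} {ρ : ℕ → ℕ} {Post Post' : (ℕ → ℕ) → Prop}

theorem mono (h : Spec D s M P t₁ ρ Post') (ht : t₁ ≤ t) (hPost : ∀ ρ', Post' ρ' → Post ρ') :
    Spec D s M P t ρ Post := by
  intro σ hσ
  obtain ⟨t', ht', σ', ρ', he, hr, hp⟩ := h σ hσ
  exact ⟨t', ht'.trans ht, σ', ρ', he, hr, hPost _ hp⟩

theorem mono_time (h : Spec D s M P t₁ ρ Post) (ht : t₁ ≤ t) : Spec D s M P t ρ Post :=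
  h.mono ht fun _ => id

theorem skip (h : Post ρ) : Spec D s M .skip 1 ρ Post :=
  fun σ hσ => ⟨1, le_rfl, σ, ρ, .skip σ, hσ, h⟩

theorem seq (h : Spec D s M P t₁ ρ fun ρ₁ => Spec D s M Q t₂ ρ₁ Post) :
    Spec D s M (.seq P Q) (t₁ + t₂) ρ Post := by
  intro σ hσ
  obtain ⟨t', ht', σ₁, ρ₁, he, hr, hp⟩ := h σ hσ
  obtain ⟨t'', ht'', σ₂, ρ₂, he', hr', hp'⟩ := hp σ₁ hr
  exact ⟨t' + t'', by omega, σ₂, ρ₂, .seq he he', hr', hp'⟩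

theorem ofNat_inj_iff {x y : ℕ} (hx : x < 2 ^ b) (hy : y < 2 ^ b) :
    BitVec.ofNat b x = BitVec.ofNat b y ↔ x = y := by
  rw [← BitVec.toNat_inj, BitVec.toNat_ofNat, BitVec.toNat_ofNat, Nat.mod_eq_of_lt hx,
    Nat.mod_eq_of_lt hy]

theorem holds_lt {σ : State b} (hσ : Holds M σ ρ) {x y : ℕ} (hx : ρ x < 2 ^ b) (hy : ρ y < 2 ^ b) :
    (Test.lt (M + x) (M + y)).Holds σ ↔ ρ x < ρ y := by
  rw [Test.Holds, hσ, hσ, BitVec.toNat_ofNat, BitVec.toNat_ofNat, Nat.mod_eq_of_lt hx,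
    Nat.mod_eq_of_lt hy]

theorem ite_lt {x y : ℕ} (hx : ρ x < 2 ^ b) (hy : ρ y < 2 ^ b)
    (hP : ρ x < ρ y → Spec D s M P t ρ Post) (hQ : ρ y ≤ ρ x → Spec D s M Q t ρ Post) :
    Spec D s M (.ite (.lt (M + x) (M + y)) P Q) (t + 1) ρ Post := by
  intro σ hσ
  by_cases h : ρ x < ρ y
  · obtain ⟨t', ht', σ', ρ', he, hr, hp⟩ := hP h σ hσ
    exact ⟨t' + 1, by omega, σ', ρ', .ite_true ((holds_lt hσ hx hy).mpr h) he, hr, hp⟩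
  · obtain ⟨t', ht', σ', ρ', he, hr, hp⟩ := hQ (not_lt.mp h) σ hσ
    exact ⟨t' + 1, by omega, σ', ρ', .ite_false (mt (holds_lt hσ hx hy).mp h) he, hr, hp⟩

theorem ite_eq {x y : ℕ} (hx : ρ x < 2 ^ b) (hy : ρ y < 2 ^ b)
    (hP : ρ x = ρ y → Spec D s M P t ρ Post) (hQ : ρ x ≠ ρ y → Spec D s M Q t ρ Post) :
    Spec D s M (.ite (.eq (M + x) (M + y)) P Q) (t + 1) ρ Post := by
  intro σ hσ
  have hiff : (Test.eq (M + x) (M + y)).Holds σ ↔ ρ x = ρ y := by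
    rw [Test.Holds, hσ, hσ, ofNat_inj_iff hx hy]
  by_cases h : ρ x = ρ y
  · obtain ⟨t', ht', σ', ρ', he, hr, hp⟩ := hP h σ hσ
    exact ⟨t' + 1, by omega, σ', ρ', .ite_true (hiff.mpr h) he, hr, hp⟩
  · obtain ⟨t', ht', σ', ρ', he, hr, hp⟩ := hQ h σ hσ
    exact ⟨t' + 1, by omega, σ', ρ', .ite_false (mt hiff.mp h) he, hr, hp⟩

theorem loop_exit {x y : ℕ} (hx : ρ x < 2 ^ b) (hy : ρ y < 2 ^ b) (h : ρ y ≤ ρ x) (hp : Post ρ) :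
    Spec D s M (.loop (.lt (M + x) (M + y)) P) 1 ρ Post := by
  intro σ hσ
  exact ⟨1, le_rfl, σ, ρ, .loop_false (mt (holds_lt hσ hx hy).mp h.not_gt), hσ, hp⟩

theorem loop_step {x y : ℕ} (hx : ρ x < 2 ^ b) (hy : ρ y < 2 ^ b) (h : ρ x < ρ y)
    (hP : Spec D s M P t₁ ρ fun ρ₁ =>
      Spec D s M (.loop (.lt (M + x) (M + y)) P) t₂ ρ₁ Post) :
    Spec D s M (.loop (.lt (M + x) (M + y)) P) (t₁ + t₂ + 1) ρ Post := by
  intro σ hσ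
  obtain ⟨t', ht', σ₁, ρ₁, he, hr, hp⟩ := hP σ hσ
  obtain ⟨t'', ht'', σ₂, ρ₂, he', hr', hp'⟩ := hp σ₁ hr
  exact ⟨t' + t'' + 1, by omega, σ₂, ρ₂, .loop_true ((holds_lt hσ hx hy).mpr h) he he', hr', hp'⟩

end Spec

theorem Holds.setReg {M : ℕ} {σ : State b} {ρ : ℕ → ℕ} (hσ : Holds M σ ρ) (r v : ℕ)
    {w : BitVec b} (hw : w = BitVec.ofNat b v) :
    Holds M (σ.setReg (M + r) w) (Function.update ρ r v) := by
  intro i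
  rw [State.setReg]
  by_cases h : i = r
  · subst h
    simp [hw]
  · rw [Function.update_of_ne h]
    simp only
    rw [Function.update_of_ne (by omega)]
    exact hσ i

/-- The number in cell `a` of the read-only array (`0` outside the array). -/
def cell (D : List (BitVec b)) (a : ℕ) : ℕ := (D.getD a 0).toNat

/-- Instructions on the registers from `M` on, which are referred to relative to `M`. -/
inductive Instr where
  | const (r k : ℕ)
  | move (r x : ℕ)
  | add (r x y : ℕ)
  | sub (r x y : ℕ)
  | mul (r x y : ℕ)
  | div (r x y : ℕ)
  | mod (r x y : ℕ)
  | read (r a : ℕ)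

namespace Instr

def toProg (M : ℕ) : Instr → Prog
  | const r k => .const (M + r) k
  | move r x => .move (M + r) (M + x)
  | add r x y => .op .add (M + r) (M + x) (M + y)
  | sub r x y => .op .sub (M + r) (M + x) (M + y)
  | mul r x y => .op .mul (M + r) (M + x) (M + y)
  | div r x y => .op .div (M + r) (M + x) (M + y)
  | mod r x y => .op .mod (M + r) (M + x) (M + y)
  | read r a => .read (M + r) (M + a)

/-- The effect of an instruction on numbers. -/
def eval (D : List (BitVec b)) (ρ : ℕ → ℕ) : Instr → ℕ → ℕ
  | const r k => Function.update ρ r k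
  | move r x => Function.update ρ r (ρ x)
  | add r x y => Function.update ρ r (ρ x + ρ y)
  | sub r x y => Function.update ρ r (ρ x - ρ y)
  | mul r x y => Function.update ρ r (ρ x * ρ y)
  | div r x y => Function.update ρ r (ρ x / ρ y)
  | mod r x y => Function.update ρ r (ρ x % ρ y)
  | read r a => Function.update ρ r (cell D (ρ a))

/-- The conditions under which the operation on words of `b` bits agrees with the one on numbers. -/
def Ok (D : List (BitVec b)) (ρ : ℕ → ℕ) : Instr → Prop
  | sub _ x y => ρ y ≤ ρ x ∧ ρ x < 2 ^ b
  | div _ x y => ρ x < 2 ^ b ∧ ρ y < 2 ^ b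
  | mod _ x y => ρ x < 2 ^ b ∧ ρ y < 2 ^ b
  | read _ a => ρ a < D.length
  | _ => True

theorem spec (hD : D.length ≤ 2 ^ b) {M : ℕ} {ρ : ℕ → ℕ} {Post : (ℕ → ℕ) → Prop} (i : Instr)
    (hi : i.Ok D ρ) (h : Post (i.eval D ρ)) : Spec D s M (i.toProg M) 1 ρ Post := by
  intro σ hσ
  cases i with
  | const r k => exact ⟨1, le_rfl, _, _, .const _ _ _, hσ.setReg r k rfl, h⟩
  | move r x => exact ⟨1, le_rfl, _, _, .move _ _ _, hσ.setReg r (ρ x) (hσ x), h⟩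
  | add r x y =>
    refine ⟨1, le_rfl, _, _, .op _ _ _ _ _, hσ.setReg r (ρ x + ρ y) ?_, h⟩
    rw [hσ, hσ, Op.eval, BitVec.ofNat_add]
  | sub r x y =>
    refine ⟨1, le_rfl, _, _, .op _ _ _ _ _, hσ.setReg r (ρ x - ρ y) ?_, h⟩
    rw [hσ, hσ, Op.eval, BitVec.ofNat_sub_ofNat_of_le _ _ (hi.1.trans_lt hi.2) hi.1]
  | mul r x y =>
    refine ⟨1, le_rfl, _, _, .op _ _ _ _ _, hσ.setReg r (ρ x * ρ y) ?_, h⟩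
    rw [hσ, hσ, Op.eval, BitVec.ofNat_mul]
  | div r x y =>
    refine ⟨1, le_rfl, _, _, .op _ _ _ _ _, hσ.setReg r (ρ x / ρ y) ?_, h⟩
    rw [hσ, hσ, Op.eval]
    apply BitVec.eq_of_toNat_eq
    rw [BitVec.toNat_udiv, BitVec.toNat_ofNat, BitVec.toNat_ofNat, BitVec.toNat_ofNat,
      Nat.mod_eq_of_lt hi.1, Nat.mod_eq_of_lt hi.2,
      Nat.mod_eq_of_lt ((Nat.div_le_self _ _).trans_lt hi.1)]
  | mod r x y =>
    refine ⟨1, le_rfl, _, _, .op _ _ _ _ _, hσ.setReg r (ρ x % ρ y) ?_, h⟩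
    rw [hσ, hσ, Op.eval]
    apply BitVec.eq_of_toNat_eq
    rw [BitVec.toNat_umod, BitVec.toNat_ofNat, BitVec.toNat_ofNat, BitVec.toNat_ofNat,
      Nat.mod_eq_of_lt hi.1, Nat.mod_eq_of_lt hi.2,
      Nat.mod_eq_of_lt ((Nat.mod_le _ _).trans_lt hi.1)]
  | read r a =>
    have ha : (σ.reg (M + a)).toNat = ρ a := by
      rw [hσ, BitVec.toNat_ofNat, Nat.mod_eq_of_lt (lt_of_lt_of_le hi hD)]
    have hlt : (σ.reg (M + a)).toNat < D.length := ha ▸ hi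
    refine ⟨1, le_rfl, _, _, .read _ _ _ hlt, hσ.setReg r (cell D (ρ a)) ?_, h⟩
    rw [cell, BitVec.ofNat_toNat, BitVec.setWidth_eq, ← ha, List.getD_eq_getElem _ _ hlt]

end Instr

/-- Straight-line programs. -/
def block (M : ℕ) : List Instr → Prog
  | [] => .skip
  | i :: l => .seq (i.toProg M) (block M l)

/-- The effect of a straight-line program on numbers. -/
def evalBlock (D : List (BitVec b)) : List Instr → (ℕ → ℕ) → ℕ → ℕ
  | [], ρ => ρ
  | i :: l, ρ => evalBlock D l (i.eval D ρ)

/-- All instructions of a straight-line program are `Ok` when they are executed. -/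
def OkBlock (D : List (BitVec b)) : List Instr → (ℕ → ℕ) → Prop
  | [], _ => True
  | i :: l, ρ => i.Ok D ρ ∧ OkBlock D l (i.eval D ρ)

theorem Spec.block (hD : D.length ≤ 2 ^ b) {M : ℕ} {ρ : ℕ → ℕ} {Post : (ℕ → ℕ) → Prop}
    (l : List Instr) (hl : OkBlock D l ρ) (h : Post (evalBlock D l ρ)) :
    Spec D s M (block M l) (l.length + 1) ρ Post := by
  induction l generalizing ρ with
  | nil => exact .skip h
  | cons i l ih =>
    refine Spec.mono_time (.seq (Instr.spec hD i hl.1 (ih hl.2 h))) ?_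
    rw [List.length_cons]
    omega

/-! ### Calling the evaluation program -/

/-- Evaluate `h` on the values in `x` and `y` and the lengths in `lx` and `ly`, with result in `r`. -/
def call (M : ℕ) (H : Prog) (r x y lx ly : ℕ) : Prog :=
  .seq (.move 0 (M + x)) (.seq (.move 1 (M + y)) (.seq (.move 2 (M + lx)) (.seq (.move 3 (M + ly))
    (.seq H (.move (M + r) 0)))))

/-- `call M H` turns the codes of two words of total length at most `n` into the code of their
concatenation, in at most `t` steps. -/
def Evaluates {α : Type*} (D : List (BitVec b)) (s M : ℕ) (H : Prog) (n t : ℕ)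
    (code : List α → ℕ) : Prop :=
  ∀ (ρ : ℕ → ℕ) (Post : (ℕ → ℕ) → Prop) (r x y lx ly : ℕ) (X Y : List α),
    X.length + Y.length ≤ n → ρ x = code X → ρ y = code Y → ρ lx = X.length → ρ ly = Y.length →
    Post (Function.update ρ r (code (X ++ Y))) → Spec D s M (call M H r x y lx ly) t ρ Post

theorem evaluates {α S : Type*} {n T M : ℕ} {H : Prog} {f : List α → S}
    {h : S → S → ℕ → ℕ → S} {enc : S → BitVec b} (hM : 4 ≤ M) (hHM : H.bound ≤ M)
    (hf : ∀ x y : List α, f (x ++ y) = h (f x) (f y) x.length y.length)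
    (hH : ∀ (u v : S) (l₁ l₂ : ℕ), l₁ + l₂ ≤ n →
      H.Computes D s T [enc u, enc v, BitVec.ofNat b l₁, BitVec.ofNat b l₂] (enc (h u v l₁ l₂))) :
    Evaluates D s M H n (T + 5) fun X => (enc (f X)).toNat := by
  intro ρ Post r x y lx ly X Y hn hx hy hlx hly hpost σ hσ
  set σ₁ := σ.setReg 0 (σ.reg (M + x)) with hσ₁
  set σ₂ := σ₁.setReg 1 (σ₁.reg (M + y)) with hσ₂
  set σ₃ := σ₂.setReg 2 (σ₂.reg (M + lx)) with hσ₃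
  set σ₄ := σ₃.setReg 3 (σ₃.reg (M + ly)) with hσ₄
  have key : ∀ (τ : State b) (r : ℕ) (v : BitVec b) (i : ℕ), r < M →
      (τ.setReg r v).reg (M + i) = τ.reg (M + i) := fun τ r v i hr =>
    Function.update_of_ne (by omega) _ _
  have h₁ : ∀ i, σ₁.reg (M + i) = σ.reg (M + i) := fun i => key _ _ _ _ (by omega)
  have h₂ : ∀ i, σ₂.reg (M + i) = σ.reg (M + i) := fun i => (key _ _ _ _ (by omega)).trans (h₁ i)
  have h₃ : ∀ i, σ₃.reg (M + i) = σ.reg (M + i) := fun i => (key _ _ _ _ (by omega)).trans (h₂ i)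
  have h₄ : ∀ i, σ₄.reg (M + i) = σ.reg (M + i) := fun i => (key _ _ _ _ (by omega)).trans (h₃ i)
  have hofNat : ∀ v : BitVec b, BitVec.ofNat b v.toNat = v := fun v => by simp
  have h0 : σ₄.reg 0 = enc (f X) := by
    simp [hσ₄, hσ₃, hσ₂, hσ₁, State.setReg, hσ x, hx]
  have h1 : σ₄.reg 1 = enc (f Y) := by
    have : σ₄.reg 1 = σ₁.reg (M + y) := by simp [hσ₄, hσ₃, hσ₂, State.setReg]
    rw [this, h₁, hσ, hy, hofNat]
  have h2 : σ₄.reg 2 = BitVec.ofNat b X.length := by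
    have : σ₄.reg 2 = σ₂.reg (M + lx) := by simp [hσ₄, hσ₃, State.setReg]
    rw [this, h₂, hσ, hlx]
  have h3 : σ₄.reg 3 = BitVec.ofNat b Y.length := by
    have : σ₄.reg 3 = σ₃.reg (M + ly) := by simp [hσ₄, State.setReg]
    rw [this, h₃, hσ, hly]
  obtain ⟨t, ht, σ₅, hex, hres⟩ := hH (f X) (f Y) X.length Y.length hn σ₄ (by
    intro i hi
    simp only [List.length_cons, List.length_nil] at hi
    interval_cases i <;> simp [h0, h1, h2, h3])
  have hσ₅ : Holds M σ₅ ρ := fun i => by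
    rw [hex.reg_eq_of_bound_le _ (by omega), h₄, hσ]
  refine ⟨1 + (1 + (1 + (1 + (t + 1)))), by omega, _, _, .seq (.move _ _ _) (.seq (.move _ _ _)
    (.seq (.move _ _ _) (.seq (.move _ _ _) (.seq hex (.move _ _ _))))), hσ₅.setReg r _ ?_, hpost⟩
  rw [hres, ← hf, hofNat]

end WordRAM

/-! ### Prefixes and suffixes of concatenations -/

section Words

variable {α : Type*}

/-- The `q`-th power of a word. -/
def pw (u : List α) (q : ℕ) : List α := (List.replicate q u).flatten

/-- Concatenation, in reverse order if `dir` is true. It is used to treat prefixes and suffixes at the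
same time. -/
def join (dir : Bool) (x y : List α) : List α := if dir then y ++ x else x ++ y

/-- The prefix of length `m` of `x`, or the suffix of length `m` if `dir` is true. -/
def part (dir : Bool) (x : List α) (m : ℕ) : List α := if dir then x.drop (x.length - m) else x.take m

variable (dir : Bool) (x y z u v : List α) (m p q : ℕ)

@[simp] theorem pw_zero : pw u 0 = [] := rfl

theorem pw_succ : pw u (q + 1) = u ++ pw u q := by simp [pw, List.replicate_succ]

theorem pw_add : pw u (p + q) = pw u p ++ pw u q := by
  rw [pw, List.replicate_add, List.flatten_append]
  rfl

@[simp] theorem pw_one : pw u 1 = u := by simp [pw]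

@[simp] theorem length_pw : (pw u q).length = q * u.length := by simp [pw]

theorem pw_append_self : pw (u ++ u) q = pw u (2 * q) := by
  induction q with
  | zero => rfl
  | succ q ih => rw [pw_succ, ih, mul_add_one, Nat.add_comm, pw_add, pw_succ u 1, pw_one]

theorem join_pw : join dir (pw u p) (pw u q) = pw u (p + q) := by
  cases dir
  · exact (pw_add u p q).symm
  · rw [add_comm, pw_add]; rfl

theorem join_assoc : join dir (join dir x y) z = join dir x (join dir y z) := by
  cases dir <;> simp [join]

@[simp] theorem length_join : (join dir x y).length = x.length + y.length := by
  cases dir <;> simp [join, add_comm]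

@[simp] theorem join_nil : join dir x [] = x := by cases dir <;> simp [join]

@[simp] theorem part_zero : part dir x 0 = [] := by cases dir <;> simp [part]

@[simp] theorem part_length : part dir x x.length = x := by cases dir <;> simp [part]

theorem length_part (h : m ≤ x.length) : (part dir x m).length = m := by
  cases dir <;> simp [part] <;> omega

theorem part_join_of_le (h : m ≤ x.length) : part dir (join dir x y) m = part dir x m := by
  cases dir
  · simp [part, join, List.take_append_of_le_length h]
  · simp only [part, join, if_true, List.length_append]
    rw [show y.length + x.length - m = y.length + (x.length - m) by omega, List.drop_append]
    simp

theorem part_join_of_ge (h : x.length ≤ m) :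
    part dir (join dir x y) m = join dir x (part dir y (m - x.length)) := by
  cases dir
  · simp [part, join, List.take_append, List.take_of_length_le h]
  · simp only [part, join, if_true, List.length_append]
    rw [show y.length + x.length - m = y.length - (m - x.length) by omega,
      List.drop_append_of_le_length (by omega)]

/-- How a prefix or suffix of `u ^ c v` decomposes: some copies of `u`, and a part of the next
factor. -/
theorem part_join_pw (c : ℕ) (hm : m ≤ c * u.length + v.length) (hq : q ≤ c)
    (hq' : q * u.length ≤ m) (hlt : q < c → m ≤ (q + 1) * u.length) :
    part dir (join dir (pw u c) v) m =
        join dir (pw u q) (part dir (if q = c then v else u) (m - q * u.length)) ∧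
      m - q * u.length ≤ (if q = c then v else u).length := by
  split_ifs with h
  · subst h
    rw [part_join_of_ge _ _ _ _ (by simpa using hq'), length_pw]
    exact ⟨rfl, by omega⟩
  · have hqc : q < c := by omega
    have h1 := hlt hqc
    rw [add_one_mul] at h1
    obtain ⟨k, rfl⟩ : ∃ k, c = q + (1 + k) := ⟨c - q - 1, by omega⟩
    rw [← join_pw dir, ← join_pw dir, pw_one, join_assoc, join_assoc,
      part_join_of_ge _ _ _ _ (by simpa using hq'), length_pw, part_join_of_le _ _ _ _ (by omega)]
    exact ⟨rfl, by omega⟩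

end Words

namespace WordRAM

variable {α : Type*} {b : ℕ} {D : List (BitVec b)} {s M n t : ℕ} {H : Prog}
  {code : List α → ℕ}

/-! ### Powers -/

/-- Registers `0`, `1`, `2` hold these numbers throughout. -/
def Consts (ρ : ℕ → ℕ) : Prop := ρ 0 = 0 ∧ ρ 1 = 1 ∧ ρ 2 = 2

/-- Register `3` holds the code of `A` and register `4` its length. -/
def Acc (code : List α → ℕ) (ρ : ℕ → ℕ) (A : List α) : Prop := ρ 3 = code A ∧ ρ 4 = A.length

/-- Append the word in registers `8` (code) and `9` (length) to the accumulator. -/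
def accumulate (M : ℕ) (H : Prog) (dir : Bool) : Prog :=
  .seq (if dir then call M H 3 8 3 9 4 else call M H 3 3 8 4 9) (block M [.add 4 4 9])

theorem accumulate_spec (hD : D.length ≤ 2 ^ b) (hH : Evaluates D s M H n t code) (dir : Bool)
    {A U : List α} {ρ : ℕ → ℕ} (hA : Acc code ρ A) (h8 : ρ 8 = code U) (h9 : ρ 9 = U.length)
    (hn : A.length + U.length ≤ n) :
    Spec D s M (accumulate M H dir) (t + 2) ρ fun ρ' =>
      Acc code ρ' (join dir A U) ∧ ∀ i, i ∉ [3, 4] → ρ' i = ρ i := by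
  have key : ∀ v, v = code (join dir A U) → Spec D s M (block M [.add 4 4 9]) 2
      (Function.update ρ 3 v) fun ρ' =>
        Acc code ρ' (join dir A U) ∧ ∀ i, i ∉ [3, 4] → ρ' i = ρ i := by
    intro v hv
    refine Spec.block hD _ (by simp [OkBlock, Instr.Ok]) ⟨⟨?_, ?_⟩, fun i hi => ?_⟩
    · simp [evalBlock, Instr.eval, hv]
    · simp [evalBlock, Instr.eval, hA.2, h9]
    · simp only [List.mem_cons, List.not_mem_nil, or_false, not_or] at hi
      simp [evalBlock, Instr.eval, Function.update_of_ne hi.1, Function.update_of_ne hi.2]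
  cases dir
  · exact Spec.seq (hH ρ _ 3 3 8 4 9 A U hn hA.1 h8 hA.2 h9 (key _ rfl))
  · exact Spec.seq (hH ρ _ 3 8 3 9 4 U A (by omega) h8 hA.1 h9 hA.2 (key _ rfl))

/-- Append the power, with exponent in register `7`, of the word in registers `8` and `9` to the
accumulator, by repeated squaring. The last squaring is skipped, since its result might be longer than
`n`. -/
def power (M : ℕ) (H : Prog) (dir : Bool) : Prog :=
  .loop (.lt (M + 0) (M + 7)) (.seq (block M [.mod 23 7 2])
    (.seq (.ite (.lt (M + 0) (M + 23)) (accumulate M H dir) .skip)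
      (.seq (block M [.div 7 7 2])
        (.ite (.lt (M + 0) (M + 7)) (.seq (call M H 8 8 8 9 9) (block M [.add 9 9 9])) .skip))))

theorem power_spec_aux (hD : D.length ≤ 2 ^ b) (hb : n + 2 < 2 ^ b)
    (hH : Evaluates D s M H n t code) (dir : Bool) (q : ℕ) :
    ∀ (A U : List α) (ρ : ℕ → ℕ), Consts ρ → Acc code ρ A → ρ 7 = q → ρ 8 = code U →
      ρ 9 = U.length → U ≠ [] → A.length + q * U.length ≤ n →
    Spec D s M (power M H dir) (if q = 0 then 1 else (2 * t + 11) * (Nat.log 2 q + 1) + 1) ρ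
      fun ρ' => Acc code ρ' (join dir A (pw U q)) ∧ ∀ i, i ∉ [3, 4, 7, 8, 9, 23] → ρ' i = ρ i := by
  induction q using Nat.strong_induction_on with
  | _ q ih =>
  intro A U ρ hc hA h7 h8 h9 hU hn
  have hUpos := List.length_pos_of_ne_nil hU
  have hqn : q ≤ n := (Nat.le_mul_of_pos_right q hUpos).trans (by omega)
  obtain ⟨h0, h1, h2⟩ := hc
  rcases Nat.eq_zero_or_pos q with rfl | hq
  · rw [if_pos rfl]
    exact Spec.loop_exit (by rw [h0]; omega) (by rw [h7]; omega) (by rw [h0, h7])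
      ⟨by simpa using hA, fun _ _ => rfl⟩
  set q' := q / 2 with hq'
  have hlen : q * U.length = q % 2 * U.length + 2 * q' * U.length := by
    rw [← add_mul]; congr 1; omega
  refine Spec.mono_time (t₁ := (2 + ((t + 3) + (2 + (t + 3)))) +
    (if q' = 0 then 1 else (2 * t + 11) * (Nat.log 2 q' + 1) + 1) + 1) ?_ ?_
  · refine Spec.loop_step (by rw [h0]; omega) (by rw [h7]; omega) (by rw [h0, h7]; exact hq) ?_
    refine Spec.seq (Spec.block hD _ ?_ ?_)
    · simp only [OkBlock, Instr.Ok, h7, h2, and_true]; omega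
    have e1 : evalBlock D [.mod 23 7 2] ρ = Function.update ρ 23 (q % 2) := by
      simp [evalBlock, Instr.eval, h7, h2]
    rw [e1]
    refine Spec.seq (Spec.mono (t₁ := t + 3) (Post' := fun ρ₂ =>
      Acc code ρ₂ (join dir A (pw U (q % 2))) ∧ ∀ i, i ∉ [3, 4, 23] → ρ₂ i = ρ i) ?_ le_rfl ?_)
    · refine Spec.ite_lt (by simp [h0]) (by simp; omega) (fun hlt => ?_) (fun hle => ?_)
      · have hq1 : q % 2 = 1 := by simp [h0] at hlt; omega
        rw [hq1] at hlen ⊢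
        refine (accumulate_spec hD hH dir (A := A) (U := U) ⟨by simp [hA.1], by simp [hA.2]⟩
          (by simp [h8]) (by simp [h9]) (by nlinarith)).mono le_rfl ?_
        rintro ρ₂ ⟨hA₂, hρ₂⟩
        refine ⟨by simpa using hA₂, fun i hi => ?_⟩
        simp only [List.mem_cons, List.not_mem_nil, or_false, not_or] at hi hρ₂
        rw [hρ₂ i (by tauto), Function.update_of_ne hi.2.2]
      · have hq1 : q % 2 = 0 := by simp [h0] at hle; omega
        rw [hq1]
        refine (Spec.skip ⟨⟨by simp [hA.1], by simp [hA.2]⟩, fun i hi => ?_⟩).mono_time (by omega)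
        simp only [List.mem_cons, List.not_mem_nil, or_false, not_or] at hi
        rw [Function.update_of_ne hi.2.2]
    rintro ρ₂ ⟨hA₂, hρ₂⟩
    have g0 : ρ₂ 0 = 0 := (hρ₂ 0 (by simp)).trans h0
    have g1 : ρ₂ 1 = 1 := (hρ₂ 1 (by simp)).trans h1
    have g2 : ρ₂ 2 = 2 := (hρ₂ 2 (by simp)).trans h2
    have g7 : ρ₂ 7 = q := (hρ₂ 7 (by simp)).trans h7
    have g8 : ρ₂ 8 = code U := (hρ₂ 8 (by simp)).trans h8
    have g9 : ρ₂ 9 = U.length := (hρ₂ 9 (by simp)).trans h9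
    refine Spec.seq (Spec.block hD _ ?_ ?_)
    · simp only [OkBlock, Instr.Ok, g7, g2, and_true]; omega
    have e2 : evalBlock D [.div 7 7 2] ρ₂ = Function.update ρ₂ 7 q' := by
      simp [evalBlock, Instr.eval, g7, g2, hq']
    rw [e2]
    have hlenA : (join dir A (pw U (q % 2))).length + q' * (2 * U.length) ≤ n := by
      rw [length_join, length_pw]
      nlinarith
    refine Spec.mono (t₁ := t + 3) (Post' := fun ρ₃ => (0 < q' →
      ρ₃ 8 = code (U ++ U) ∧ ρ₃ 9 = (U ++ U).length) ∧ ρ₃ 7 = q' ∧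
        ∀ i, i ∉ [7, 8, 9] → ρ₃ i = ρ₂ i) ?_ le_rfl ?_
    · refine Spec.ite_lt (by simp [g0]) (by simp; omega) (fun hlt => ?_) (fun hle => ?_)
      · have hq0 : 0 < q' := by simpa [g0] using hlt
        refine Spec.seq (t₁ := t) (t₂ := 2) (hH _ _ 8 8 8 9 9 U U ?_ (by simp [g8]) (by simp [g8])
          (by simp [g9]) (by simp [g9]) ?_)
        · nlinarith
        refine Spec.block hD _ (by simp [OkBlock, Instr.Ok]) ⟨fun _ => ⟨?_, ?_⟩, ?_, fun i hi => ?_⟩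
        · simp [evalBlock, Instr.eval]
        · simp [evalBlock, Instr.eval, g9]
        · simp [evalBlock, Instr.eval]
        · simp only [List.mem_cons, List.not_mem_nil, or_false, not_or] at hi
          simp [evalBlock, Instr.eval, Function.update_of_ne hi.1, Function.update_of_ne hi.2.1,
            Function.update_of_ne hi.2.2]
      · have hq0 : q' = 0 := by simpa [g0] using hle
        refine (Spec.skip ⟨by simp [hq0], by simp, fun i hi => ?_⟩).mono_time (by omega)
        simp only [List.mem_cons, List.not_mem_nil, or_false, not_or] at hi
        rw [Function.update_of_ne hi.1]
    rintro ρ₃ ⟨hU₃, k7, hρ₃⟩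
    have hc₃ : Consts ρ₃ := ⟨(hρ₃ 0 (by simp)).trans g0, (hρ₃ 1 (by simp)).trans g1,
      (hρ₃ 2 (by simp)).trans g2⟩
    have hA₃ : Acc code ρ₃ (join dir A (pw U (q % 2))) :=
      ⟨(hρ₃ 3 (by simp)).trans hA₂.1, (hρ₃ 4 (by simp)).trans hA₂.2⟩
    have hframe : ∀ i, i ∉ [3, 4, 7, 8, 9, 23] → ρ₃ i = ρ i := fun i hi => by
      simp only [List.mem_cons, List.not_mem_nil, or_false, not_or] at hi hρ₂ hρ₃
      rw [hρ₃ i (by tauto), hρ₂ i (by tauto)]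
    rcases Nat.eq_zero_or_pos q' with hq0 | hq0
    · rw [if_pos hq0]
      refine Spec.loop_exit (by rw [hc₃.1]; omega) (by rw [k7]; omega)
        (by rw [hc₃.1, k7, hq0]) ⟨?_, hframe⟩
      rwa [show q % 2 = q by omega] at hA₃
    · replace hU₃ := hU₃ hq0
      refine (ih q' (by omega) _ (U ++ U) ρ₃ hc₃ hA₃ k7 hU₃.1 hU₃.2 (by simp [hU])
        (by rw [List.length_append, ← two_mul]; exact hlenA)).mono le_rfl ?_
      rintro ρ₄ ⟨hA₄, hρ₄⟩
      rw [pw_append_self, join_assoc, join_pw, show q % 2 + 2 * q' = q by omega] at hA₄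
      exact ⟨hA₄, fun i hi => (hρ₄ i hi).trans (hframe i hi)⟩
  · rw [if_neg hq.ne']
    split_ifs with hq0
    · nlinarith [Nat.zero_le (Nat.log 2 q)]
    · have h3 : Nat.log 2 q = Nat.log 2 q' + 1 := Nat.log_of_one_lt_of_le (by norm_num) (by omega)
      rw [h3]
      nlinarith

theorem power_spec (hD : D.length ≤ 2 ^ b) (hb : n + 2 < 2 ^ b) (hH : Evaluates D s M H n t code)
    (dir : Bool) {q : ℕ} {A U : List α} {ρ : ℕ → ℕ} (hc : Consts ρ) (hA : Acc code ρ A)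
    (h7 : ρ 7 = q) (h8 : ρ 8 = code U) (h9 : ρ 9 = U.length) (hU : U ≠ [])
    (hn : A.length + q * U.length ≤ n) :
    Spec D s M (power M H dir) ((2 * t + 11) * (Nat.log 2 q + 1) + 1) ρ
      fun ρ' => Acc code ρ' (join dir A (pw U q)) ∧ ∀ i, i ∉ [3, 4, 7, 8, 9, 23] → ρ' i = ρ i :=
  (power_spec_aux hD hb hH dir q A U ρ hc hA h7 h8 h9 hU hn).mono_time (by split_ifs <;> omega)

end WordRAM

namespace WordRAM

variable {α : Type*} {b : ℕ} {D : List (BitVec b)} {s M n t : ℕ} {H : Prog}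
  {code : List α → ℕ} {W : Set (List α)} {ptr rk : List α → ℕ}

/-! ### The index -/

/-- The array `D` stores, at address `ptr x` for every word `x` of `W`, a record of five cells: the
length and the code of `x` and, if `x` is not a single symbol, a rule `x = u ^ c v` in the form
`ptr u`, `ptr v`, `c`. Here `c = 1` for a concatenation and `u = v` for a run, so that also
`x = v u ^ c` if `u` and `v` are exchanged. `rk` is a rank that decreases along the rules. -/
structure IsIndex (D : List (BitVec b)) (n : ℕ) (code : List α → ℕ) (W : Set (List α))
    (ptr rk : List α → ℕ) : Prop where
  length_le : D.length ≤ 2 ^ b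
  lt : ∀ x ∈ W, ptr x + 4 < D.length
  le : ∀ x ∈ W, x.length ≤ n
  ne_nil : ∀ x ∈ W, x ≠ []
  len : ∀ x ∈ W, cell D (ptr x) = x.length
  val : ∀ x ∈ W, cell D (ptr x + 1) = code x
  rule : ∀ x ∈ W, 2 ≤ x.length → ∃ u ∈ W, ∃ v ∈ W, ∃ c, 1 ≤ c ∧ x = pw u c ++ v ∧
    (c = 1 ∨ u = v) ∧ rk u + Nat.log 2 c < rk x ∧ rk v + Nat.log 2 c < rk x ∧
    cell D (ptr x + 2) = ptr u ∧ cell D (ptr x + 3) = ptr v ∧ cell D (ptr x + 4) = c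

theorem IsIndex.rule_join (hI : IsIndex D n code W ptr rk) (dir : Bool) {x : List α} (hx : x ∈ W)
    (h : 2 ≤ x.length) : ∃ u ∈ W, ∃ v ∈ W, ∃ c, 1 ≤ c ∧ x = join dir (pw u c) v ∧
      rk u + Nat.log 2 c < rk x ∧ rk v + Nat.log 2 c < rk x ∧
      cell D (ptr x + if dir then 3 else 2) = ptr u ∧
      cell D (ptr x + if dir then 2 else 3) = ptr v ∧ cell D (ptr x + 4) = c := by
  obtain ⟨u, hu, v, hv, c, hc, hxe, hor, hru, hrv, h2, h3, h4⟩ := hI.rule x hx h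
  cases dir
  · exact ⟨u, hu, v, hv, c, hc, hxe, hru, hrv, h2, h3, h4⟩
  · refine ⟨v, hv, u, hu, c, hc, ?_, hrv, hru, h3, h2, h4⟩
    rcases hor with rfl | rfl
    · simpa [join] using hxe
    · rw [hxe, join, if_pos rfl, ← pw_succ, pw_add, pw_one]

/-! ### Prefix and suffix queries -/

/-- The code that enters the rule of the word at the address in register `5`. Register `6` holds a
number smaller than the length of this word. Afterwards, `7`, `8`, `9` describe the power that has to
be appended to the accumulator, and `5` and `6` the remaining query. -/
def enter (M : ℕ) (dir : Bool) : Prog :=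
  .seq (block M [.const 14 (if dir then 3 else 2), .add 14 14 5, .read 11 14,
      .const 14 (if dir then 2 else 3), .add 14 14 5, .read 12 14,
      .const 14 4, .add 14 14 5, .read 13 14, .read 9 11, .div 7 6 9])
    (.seq (.ite (.lt (M + 13) (M + 7)) (block M [.move 7 13]) .skip)
      (.seq (block M [.const 14 1, .add 14 14 11, .read 8 14, .mul 14 7 9, .sub 6 6 14])
        (.ite (.eq (M + 7) (M + 13)) (block M [.move 5 12]) (block M [.move 5 11]))))

/-- Append the prefix (or suffix) whose length is in register `6`, of the word at the address in
register `5`, to the accumulator. -/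
def walk (M : ℕ) (H : Prog) (dir : Bool) : Prog :=
  .loop (.lt (M + 0) (M + 6)) (.seq (block M [.read 10 5])
    (.ite (.lt (M + 6) (M + 10)) (.seq (enter M dir) (power M H dir))
      (.seq (block M [.const 14 1, .add 14 14 5, .read 8 14, .move 9 10, .const 6 0])
        (accumulate M H dir))))

theorem enter_spec (hI : IsIndex D n code W ptr rk) (hb : n + 2 < 2 ^ b) (dir : Bool)
    {x : List α} (hx : x ∈ W) {m : ℕ} (hm0 : 0 < m) (hm : m < x.length) :
    ∃ u ∈ W, ∃ y ∈ W, ∃ q m', rk y + Nat.log 2 q < rk x ∧ m' ≤ y.length ∧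
      m = q * u.length + m' ∧ part dir x m = join dir (pw u q) (part dir y m') ∧
      ∀ ρ : ℕ → ℕ, ρ 5 = ptr x → ρ 6 = m → Spec D s M (enter M dir) 24 ρ fun ρ' =>
        ρ' 5 = ptr y ∧ ρ' 6 = m' ∧ ρ' 7 = q ∧ ρ' 8 = code u ∧ ρ' 9 = u.length ∧
        ∀ i, i ∉ [5, 6, 7, 8, 9, 11, 12, 13, 14] → ρ' i = ρ i := by
  have hD := hI.length_le
  obtain ⟨u, hu, v, hv, c, hc, hxe, hru, hrv, h2, h3, h4⟩ := hI.rule_join dir hx (by omega)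
  have hxlt := hI.lt x hx
  have hult := hI.lt u hu
  have hxn := hI.le x hx
  have hupos := List.length_pos_of_ne_nil (hI.ne_nil u hu)
  have hlen : x.length = c * u.length + v.length := by
    conv_lhs => rw [hxe]
    simp
  have hcx : c ≤ x.length := by nlinarith
  have hux : u.length ≤ x.length := by nlinarith
  have g1 := hI.len u hu
  have g2 := hI.val u hu
  have hq7 : m / u.length ≤ m := Nat.div_le_self _ _
  set q := min (m / u.length) c with hq
  have hqu : q * u.length ≤ m :=
    (Nat.mul_le_mul_right _ (min_le_left _ _)).trans (Nat.div_mul_le_self _ _)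
  have hpart := part_join_pw dir u v m q c (by omega) (min_le_right _ _) hqu fun hlt => by
    rw [show q = m / u.length by omega]
    exact (Nat.lt_mul_of_div_lt (Nat.lt_succ_self _) hupos).le
  rw [← hxe] at hpart
  have hlogq : Nat.log 2 q ≤ Nat.log 2 c := Nat.log_mono_right (min_le_right _ _)
  refine ⟨u, hu, if q = c then v else u, by split_ifs <;> assumption, q, m - q * u.length,
    by split_ifs <;> omega, hpart.2, by omega, hpart.1, fun ρ h5 h6 => ?_⟩
  set ρ₁ := evalBlock D [.const 14 (if dir then 3 else 2), .add 14 14 5, .read 11 14,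
      .const 14 (if dir then 2 else 3), .add 14 14 5, .read 12 14,
      .const 14 4, .add 14 14 5, .read 13 14, .read 9 11, .div 7 6 9] ρ with hρ₁
  have hdir1 : (if dir then 3 else 2) < 4 := by split_ifs <;> omega
  have hdir2 : (if dir then 2 else 3) < 4 := by split_ifs <;> omega
  rw [add_comm] at h2 h3 h4
  have e11 : ρ₁ 11 = ptr u := by simp [hρ₁, evalBlock, Instr.eval, h5, h2]
  have e12 : ρ₁ 12 = ptr v := by simp [hρ₁, evalBlock, Instr.eval, h5, h3]
  have e13 : ρ₁ 13 = c := by simp [hρ₁, evalBlock, Instr.eval, h5, h4]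
  have e9 : ρ₁ 9 = u.length := by simp [hρ₁, evalBlock, Instr.eval, h5, h2, g1]
  have e7 : ρ₁ 7 = m / u.length := by simp [hρ₁, evalBlock, Instr.eval, h5, h6, h2, g1]
  have e6 : ρ₁ 6 = m := by simp [hρ₁, evalBlock, Instr.eval, h6]
  have ef : ∀ i, i ∉ [5, 6, 7, 8, 9, 11, 12, 13, 14] → ρ₁ i = ρ i := fun i hi => by
    simp only [List.mem_cons, List.not_mem_nil, or_false, not_or] at hi
    simp [hρ₁, evalBlock, Instr.eval, hi]
  refine Spec.mono_time (t₁ := 12 + (3 + (6 + 3))) ?_ (by omega)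
  refine Spec.seq (Spec.block hD _ ?_ ?_)
  · simp [OkBlock, Instr.Ok, Instr.eval, h5, h6, h2, g1]
    omega
  rw [← hρ₁]
  refine Spec.seq (Spec.mono (t₁ := 3) (Post' := fun ρ₂ => ρ₂ 7 = q ∧
    ∀ i, i ∉ [7] → ρ₂ i = ρ₁ i) ?_ le_rfl ?_)
  · refine Spec.ite_lt (by rw [e13]; omega) (by rw [e7]; omega) (fun hlt => ?_) (fun hle => ?_)
    · refine Spec.block hD _ (by simp [OkBlock, Instr.Ok]) ⟨?_, fun i hi => ?_⟩
      · simp [evalBlock, Instr.eval, e13, hq]; omega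
      · simp at hi; simp [evalBlock, Instr.eval, hi]
    · exact (Spec.skip ⟨by omega, fun _ _ => rfl⟩).mono_time (by omega)
  rintro ρ₂ ⟨k7, kf⟩
  have k9 := (kf 9 (by simp)).trans e9
  have k6 := (kf 6 (by simp)).trans e6
  have k11 := (kf 11 (by simp)).trans e11
  have k12 := (kf 12 (by simp)).trans e12
  have k13 := (kf 13 (by simp)).trans e13
  set ρ₃ := evalBlock D [.const 14 1, .add 14 14 11, .read 8 14, .mul 14 7 9, .sub 6 6 14] ρ₂
    with hρ₃
  rw [add_comm] at g2
  have j8 : ρ₃ 8 = code u := by simp [hρ₃, evalBlock, Instr.eval, k11, g2]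
  have j6 : ρ₃ 6 = m - q * u.length := by simp [hρ₃, evalBlock, Instr.eval, k7, k9, k6]
  have j7 : ρ₃ 7 = q := by simp [hρ₃, evalBlock, Instr.eval, k7]
  have j9 : ρ₃ 9 = u.length := by simp [hρ₃, evalBlock, Instr.eval, k9]
  have j11 : ρ₃ 11 = ptr u := by simp [hρ₃, evalBlock, Instr.eval, k11]
  have j12 : ρ₃ 12 = ptr v := by simp [hρ₃, evalBlock, Instr.eval, k12]
  have j13 : ρ₃ 13 = c := by simp [hρ₃, evalBlock, Instr.eval, k13]
  have jf : ∀ i, i ∉ [5, 6, 7, 8, 9, 11, 12, 13, 14] → ρ₃ i = ρ i := fun i hi => by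
    rw [← ef i hi]
    simp only [List.mem_cons, List.not_mem_nil, or_false, not_or] at hi
    rw [← kf i (by simp; tauto)]
    simp [hρ₃, evalBlock, Instr.eval, hi]
  refine Spec.seq (Spec.block hD _ ?_ ?_)
  · simp [OkBlock, Instr.Ok, Instr.eval, k6, k7, k9, k11]
    omega
  rw [← hρ₃]
  refine Spec.ite_eq (t := 2) (by rw [j7]; omega) (by rw [j13]; omega) (fun heq => ?_)
    (fun hne => ?_)
  · rw [j7, j13] at heq
    rw [if_pos heq]
    refine Spec.block hD _ (by simp [OkBlock, Instr.Ok]) ⟨?_, ?_, ?_, ?_, ?_, fun i hi => ?_⟩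
    · simp [evalBlock, Instr.eval, j12]
    · simp [evalBlock, Instr.eval, j6]
    · simp [evalBlock, Instr.eval, j7]
    · simp [evalBlock, Instr.eval, j8]
    · simp [evalBlock, Instr.eval, j9]
    · rw [← jf i hi]
      simp only [List.mem_cons, List.not_mem_nil, or_false, not_or] at hi
      simp [evalBlock, Instr.eval, hi]
  · rw [j7, j13] at hne
    rw [if_neg hne]
    refine Spec.block hD _ (by simp [OkBlock, Instr.Ok]) ⟨?_, ?_, ?_, ?_, ?_, fun i hi => ?_⟩
    · simp [evalBlock, Instr.eval, j11]
    · simp [evalBlock, Instr.eval, j6]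
    · simp [evalBlock, Instr.eval, j7]
    · simp [evalBlock, Instr.eval, j8]
    · simp [evalBlock, Instr.eval, j9]
    · rw [← jf i hi]
      simp only [List.mem_cons, List.not_mem_nil, or_false, not_or] at hi
      simp [evalBlock, Instr.eval, hi]

theorem walk_spec (hI : IsIndex D n code W ptr rk) (hb : n + 2 < 2 ^ b)
    (hH : Evaluates D s M H n t code) (dir : Bool) (r : ℕ) :
    ∀ (x : List α) (m : ℕ) (A : List α) (ρ : ℕ → ℕ), x ∈ W → rk x = r → m ≤ x.length →
      A.length + m ≤ n → Consts ρ → Acc code ρ A → ρ 5 = ptr x → ρ 6 = m →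
    Spec D s M (walk M H dir) ((2 * t + 40) * (r + 1)) ρ fun ρ' =>
      Acc code ρ' (join dir A (part dir x m)) ∧
        ∀ i, i ∉ [3, 4, 5, 6, 7, 8, 9, 10, 11, 12, 13, 14, 23] → ρ' i = ρ i := by
  induction r using Nat.strong_induction_on with
  | _ r ih =>
  intro x m A ρ hx hr hm hn hc hA h5 h6
  have hD := hI.length_le
  have hxlt := hI.lt x hx
  have hxn := hI.le x hx
  have hlenx := hI.len x hx
  have hvalx := hI.val x hx
  rw [add_comm] at hvalx
  obtain ⟨h0, h1, h2⟩ := hc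
  rcases Nat.eq_zero_or_pos m with rfl | hm0
  · refine (Spec.loop_exit (by rw [h0]; omega) (by rw [h6]; omega) (by rw [h0, h6])
      ⟨by simpa using hA, fun _ _ => rfl⟩).mono_time (by nlinarith)
  have e1 : evalBlock D [.read 10 5] ρ = Function.update ρ 10 x.length := by
    simp [evalBlock, Instr.eval, h5, hlenx]
  rcases Nat.lt_or_ge m x.length with hlt | hge
  · obtain ⟨u, hu, y, hy, q, m', hrk, hm', hmq, hpart, hspec⟩ :=
      enter_spec (s := s) (M := M) hI hb dir hx hm0 hlt
    rw [hr] at hrk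
    have htime : (2 * t + 40) * (rk y + Nat.log 2 q + 2) ≤ (2 * t + 40) * (r + 1) :=
      Nat.mul_le_mul_left _ (by omega)
    refine Spec.mono_time (t₁ := (2 + ((24 + ((2 * t + 11) * (Nat.log 2 q + 1) + 1)) + 1)) +
      (2 * t + 40) * (rk y + 1) + 1) ?_ (by nlinarith [Nat.zero_le (Nat.log 2 q)])
    refine Spec.loop_step (by rw [h0]; omega) (by rw [h6]; omega) (by rw [h0, h6]; exact hm0) ?_
    refine Spec.seq (Spec.block hD _ (by simp [OkBlock, Instr.Ok, h5]; omega) ?_)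
    rw [e1]
    refine Spec.ite_lt (by simp [h6]; omega) (by simp; omega) (fun _ => ?_)
      (fun hle => by simp [h6] at hle; omega)
    refine Spec.seq ((hspec _ (by simp [h5]) (by simp [h6])).mono le_rfl ?_)
    rintro ρ₁ ⟨g5, g6, g7, g8, g9, gf⟩
    have g0 : ρ₁ 0 = 0 := (gf 0 (by simp)).trans (by simpa using h0)
    have g1 : ρ₁ 1 = 1 := (gf 1 (by simp)).trans (by simpa using h1)
    have g2 : ρ₁ 2 = 2 := (gf 2 (by simp)).trans (by simpa using h2)
    have g3 : ρ₁ 3 = code A := (gf 3 (by simp)).trans (by simpa using hA.1)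
    have g4 : ρ₁ 4 = A.length := (gf 4 (by simp)).trans (by simpa using hA.2)
    refine (power_spec hD hb hH dir ⟨g0, g1, g2⟩ ⟨g3, g4⟩ g7 g8 g9 (hI.ne_nil u hu)
      (by omega)).mono le_rfl ?_
    rintro ρ₂ ⟨hA₂, hρ₂⟩
    refine (ih (rk y) (by omega) y m' _ ρ₂ hy rfl hm' ?_ ⟨?_, ?_, ?_⟩ hA₂ ?_ ?_).mono le_rfl ?_
    · rw [length_join, length_pw]; omega
    · exact (hρ₂ 0 (by simp)).trans g0
    · exact (hρ₂ 1 (by simp)).trans g1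
    · exact (hρ₂ 2 (by simp)).trans g2
    · exact (hρ₂ 5 (by simp)).trans g5
    · exact (hρ₂ 6 (by simp)).trans g6
    rintro ρ₃ ⟨hA₃, hρ₃⟩
    rw [join_assoc, ← hpart] at hA₃
    refine ⟨hA₃, fun i hi => ?_⟩
    rw [hρ₃ i hi]
    simp only [List.mem_cons, List.not_mem_nil, or_false, not_or] at hi
    rw [hρ₂ i (by simp; tauto), gf i (by simp; tauto), Function.update_of_ne (by tauto)]
  · obtain rfl : m = x.length := by omega
    refine Spec.mono_time (t₁ := (2 + ((6 + (t + 2)) + 1)) + 1 + 1) ?_ (by nlinarith)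
    refine Spec.loop_step (by rw [h0]; omega) (by rw [h6]; omega) (by rw [h0, h6]; exact hm0) ?_
    refine Spec.seq (Spec.block hD _ (by simp [OkBlock, Instr.Ok, h5]; omega) ?_)
    rw [e1]
    refine Spec.ite_lt (by simp [h6]; omega) (by simp; omega) (fun hlt => by simp [h6] at hlt)
      (fun _ => ?_)
    refine Spec.seq (Spec.block hD _ (by simp [OkBlock, Instr.Ok, Instr.eval, h5]; omega) ?_)
    set ρ₁ := evalBlock D [.const 14 1, .add 14 14 5, .read 8 14, .move 9 10, .const 6 0]
      (Function.update ρ 10 x.length) with hρ₁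
    have gf : ∀ i, i ∉ [6, 8, 9, 10, 14] → ρ₁ i = ρ i := fun i hi => by
      simp only [List.mem_cons, List.not_mem_nil, or_false, not_or] at hi
      simp [hρ₁, evalBlock, Instr.eval, hi]
    refine (accumulate_spec hD hH dir (A := A) (U := x) ⟨?_, ?_⟩ ?_ ?_ (by omega)).mono le_rfl ?_
    · exact (gf 3 (by simp)).trans hA.1
    · exact (gf 4 (by simp)).trans hA.2
    · simp [hρ₁, evalBlock, Instr.eval, h5, hvalx]
    · simp [hρ₁, evalBlock, Instr.eval]
    rintro ρ₂ ⟨hA₂, hρ₂⟩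
    have k0 : ρ₂ 0 = 0 := (hρ₂ 0 (by simp)).trans ((gf 0 (by simp)).trans h0)
    have k6 : ρ₂ 6 = 0 := (hρ₂ 6 (by simp)).trans (by simp [hρ₁, evalBlock, Instr.eval])
    refine Spec.loop_exit (by rw [k0]; omega) (by rw [k6]; omega) (by rw [k0, k6])
      ⟨by rwa [part_length], fun i hi => ?_⟩
    simp only [List.mem_cons, List.not_mem_nil, or_false, not_or] at hi
    rw [hρ₂ i (by simp; tauto), gf i (by simp; tauto)]

end WordRAM

/-- How a factor of `u ^ c v` decomposes. Either it lies in one of the `c + 1` factors, or it consists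
of a suffix of one copy of `u`, some copies of `u`, and a prefix of a later factor. -/
theorem drop_take_pw {α : Type*} {u v : List α} {c lo hi i j : ℕ} (hu : 0 < u.length)
    (hlo : lo < hi) (hhi : hi ≤ c * u.length + v.length) (hi' : i = min (lo / u.length) c)
    (hj' : j = min ((hi - 1) / u.length) c) :
    i ≤ j ∧ j ≤ c ∧ i * u.length ≤ lo ∧ j * u.length ≤ hi ∧
      hi - j * u.length ≤ (if j = c then v else u).length ∧
      (i = j → lo - i * u.length < hi - i * u.length ∧ ((pw u c ++ v).take hi).drop lo =
        ((if j = c then v else u).take (hi - i * u.length)).drop (lo - i * u.length)) ∧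
      (i < j → lo < (i + 1) * u.length ∧ ((pw u c ++ v).take hi).drop lo =
        part true u ((i + 1) * u.length - lo) ++
          (pw u (j - i - 1) ++ (if j = c then v else u).take (hi - j * u.length))) := by
  have h1 : i ≤ j := by
    rw [hi', hj']
    exact min_le_min_right _ (Nat.div_le_div_right (by omega))
  have h2 : j ≤ c := hj' ▸ min_le_right _ _
  have h3 : i * u.length ≤ lo := by
    rw [hi']
    exact (Nat.mul_le_mul_right _ (min_le_left _ _)).trans (Nat.div_mul_le_self _ _)
  have h4 : j * u.length ≤ hi - 1 := by
    rw [hj']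
    exact (Nat.mul_le_mul_right _ (min_le_left _ _)).trans (Nat.div_mul_le_self _ _)
  obtain ⟨h5, h6⟩ := part_join_pw false u v hi j c hhi h2 (by omega) fun hlt => by
    have h : hi - 1 < ((hi - 1) / u.length + 1) * u.length :=
      Nat.lt_mul_of_div_lt (Nat.lt_succ_self _) hu
    rw [show j = (hi - 1) / u.length by omega]
    omega
  simp only [part, join, Bool.false_eq_true, if_false] at h5
  refine ⟨h1, h2, h3, by omega, h6, fun hij => ?_, fun hij => ?_⟩
  · subst hij
    refine ⟨by omega, ?_⟩
    rw [h5, List.drop_append, List.drop_eq_nil_of_le (by simpa using h3)]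
    simp
  · have h7 : lo < (i + 1) * u.length := by
      rw [show i = lo / u.length by omega]
      exact Nat.lt_mul_of_div_lt (Nat.lt_succ_self _) hu
    refine ⟨h7, ?_⟩
    have h8 : pw u j = pw u i ++ (u ++ pw u (j - i - 1)) := by
      rw [← pw_succ, ← pw_add]; congr 1; omega
    rw [add_one_mul] at h7 ⊢
    rw [h5, h8, List.append_assoc, List.drop_append, List.drop_eq_nil_of_le (by simpa using h3),
      List.nil_append, length_pw, List.append_assoc, List.drop_append_of_le_length (by omega), part,
      if_pos rfl, show u.length - (i * u.length + u.length - lo) = lo - i * u.length by omega]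

namespace WordRAM

variable {α : Type*} {b : ℕ} {D : List (BitVec b)} {s M n t : ℕ} {H : Prog}
  {code : List α → ℕ} {W : Set (List α)} {ptr rk : List α → ℕ}

/-! ### Factor queries -/

/-- Read the rule `x = u ^ c v` of the word at the address in register `5`, and determine the numbers
of the factors of the rule that contain the first and the last symbol of the queried factor. -/
def locate (M : ℕ) : Prog :=
  .seq (block M [.const 14 2, .add 14 14 5, .read 11 14, .const 14 3, .add 14 14 5, .read 12 14,
      .const 14 4, .add 14 14 5, .read 13 14, .read 15 11, .div 21 16 15, .sub 23 17 1,
      .div 22 23 15])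
    (.seq (.ite (.lt (M + 13) (M + 21)) (block M [.move 21 13]) .skip)
      (.ite (.lt (M + 13) (M + 22)) (block M [.move 22 13]) .skip))

/-- Restrict the query to one factor of the rule if the first and the last symbol belong to the same
one, and split it otherwise. -/
def restrict (M : ℕ) : Prog :=
  .seq (.ite (.eq (M + 21) (M + 22))
      (block M [.mul 14 21 15, .sub 16 16 14, .sub 17 17 14])
      (block M [.move 18 11, .const 14 1, .add 14 14 21, .mul 14 14 15, .sub 19 14 16,
        .sub 20 22 21, .sub 20 20 1, .mul 14 22 15, .sub 17 17 14, .const 16 0]))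
    (.ite (.eq (M + 22) (M + 13)) (block M [.move 5 12]) (block M [.move 5 11]))

/-- Descend from the word at the address in register `5` to the place where the factor from position
`16` (exclusive) to position `17` (inclusive) is split. Afterwards, the factor is the concatenation of
the suffix with length in `19` of the word at the address in `18`, the power of this word with exponent
in `20`, and the prefix with length in `17` of the word at the address in `5`. -/
def descend (M : ℕ) : Prog :=
  .loop (.lt (M + 0) (M + 16)) (.seq (locate M) (restrict M))

/-- The result of `descend` for a factor `X`: the three pieces described there. -/
def Split (W : Set (List α)) (ptr rk : List α → ℕ) (R : ℕ) (X : List α) (ρ : ℕ → ℕ) : Prop :=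
  ∃ x ∈ W, ∃ y ∈ W, ∃ m q m', X = part true x m ++ (pw x q ++ y.take m') ∧ m ≤ x.length ∧
    m' ≤ y.length ∧ rk x ≤ R ∧ Nat.log 2 q ≤ R ∧ rk y ≤ R ∧
    ρ 18 = ptr x ∧ ρ 19 = m ∧ ρ 20 = q ∧ ρ 5 = ptr y ∧ ρ 17 = m'

theorem locate_spec (hI : IsIndex D n code W ptr rk) (hb : n + 2 < 2 ^ b) {x u v : List α}
    {c lo hi : ℕ} (hx : x ∈ W) (hu : u ∈ W) (hcx : c ≤ n) (hlo : lo < hi) (hhi : hi ≤ n)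
    (f2 : cell D (ptr x + 2) = ptr u) (f3 : cell D (ptr x + 3) = ptr v)
    (f4 : cell D (ptr x + 4) = c) {ρ : ℕ → ℕ} (h1 : ρ 1 = 1) (h5 : ρ 5 = ptr x) (h16 : ρ 16 = lo)
    (h17 : ρ 17 = hi) :
    Spec D s M (locate M) 20 ρ fun ρ' => ρ' 11 = ptr u ∧ ρ' 12 = ptr v ∧ ρ' 13 = c ∧
      ρ' 15 = u.length ∧ ρ' 21 = min (lo / u.length) c ∧ ρ' 22 = min ((hi - 1) / u.length) c ∧
      ∀ k, k ∉ [11, 12, 13, 14, 15, 21, 22, 23] → ρ' k = ρ k := by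
  have hD := hI.length_le
  have hxlt := hI.lt x hx
  have hult := hI.lt u hu
  have hlenu := hI.len u hu
  have hun := hI.le u hu
  rw [add_comm] at f2 f3 f4
  have hdivi : lo / u.length ≤ lo := Nat.div_le_self _ _
  have hdivj : (hi - 1) / u.length ≤ hi - 1 := Nat.div_le_self _ _
  set ρ₁ := evalBlock D [.const 14 2, .add 14 14 5, .read 11 14, .const 14 3, .add 14 14 5,
    .read 12 14, .const 14 4, .add 14 14 5, .read 13 14, .read 15 11, .div 21 16 15, .sub 23 17 1,
    .div 22 23 15] ρ with hρ₁
  refine Spec.mono_time (t₁ := 14 + (3 + 3)) ?_ le_rfl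
  refine Spec.seq (Spec.block hD _ ?_ ?_)
  · simp [OkBlock, Instr.Ok, Instr.eval, h5, h16, h17, h1, f2, hlenu]
    omega
  rw [← hρ₁]
  have e11 : ρ₁ 11 = ptr u := by simp [hρ₁, evalBlock, Instr.eval, h5, f2]
  have e12 : ρ₁ 12 = ptr v := by simp [hρ₁, evalBlock, Instr.eval, h5, f3]
  have e13 : ρ₁ 13 = c := by simp [hρ₁, evalBlock, Instr.eval, h5, f4]
  have e15 : ρ₁ 15 = u.length := by simp [hρ₁, evalBlock, Instr.eval, h5, f2, hlenu]
  have e21 : ρ₁ 21 = lo / u.length := by simp [hρ₁, evalBlock, Instr.eval, h5, f2, hlenu, h16]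
  have e22 : ρ₁ 22 = (hi - 1) / u.length := by
    simp [hρ₁, evalBlock, Instr.eval, h5, f2, hlenu, h17, h1]
  have ef : ∀ k, k ∉ [11, 12, 13, 14, 15, 21, 22, 23] → ρ₁ k = ρ k := fun k hk => by
    simp only [List.mem_cons, List.not_mem_nil, or_false, not_or] at hk
    simp [hρ₁, evalBlock, Instr.eval, hk]
  clear_value ρ₁
  refine Spec.seq (Spec.mono (t₁ := 3) (Post' := fun ρ₂ => ρ₂ 21 = min (lo / u.length) c ∧
    ∀ k, k ∉ [21] → ρ₂ k = ρ₁ k) ?_ le_rfl ?_)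
  · refine Spec.ite_lt (by rw [e13]; omega) (by rw [e21]; omega) (fun hlt => ?_) (fun hle => ?_)
    · refine Spec.block hD _ (by simp [OkBlock, Instr.Ok]) ⟨?_, fun k hk => ?_⟩
      · simp [evalBlock, Instr.eval, e13]; omega
      · simp at hk; simp [evalBlock, Instr.eval, hk]
    · exact (Spec.skip ⟨by omega, fun _ _ => rfl⟩).mono_time (by omega)
  rintro ρ₂ ⟨k21, kf⟩
  have k11 := (kf 11 (by simp)).trans e11
  have k12 := (kf 12 (by simp)).trans e12
  have k13 := (kf 13 (by simp)).trans e13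
  have k15 := (kf 15 (by simp)).trans e15
  have k22 := (kf 22 (by simp)).trans e22
  have hf : ∀ k, k ∉ [11, 12, 13, 14, 15, 21, 22, 23] → ρ₂ k = ρ k := fun k hk => by
    rw [← ef k hk]
    simp only [List.mem_cons, List.not_mem_nil, or_false, not_or] at hk
    exact kf k (by simp; tauto)
  refine Spec.ite_lt (by rw [k13]; omega) (by rw [k22]; omega) (fun hlt => ?_) (fun hle => ?_)
  · refine Spec.block hD _ (by simp [OkBlock, Instr.Ok]) ⟨?_, ?_, ?_, ?_, ?_, ?_, fun k hk => ?_⟩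
    · simp [evalBlock, Instr.eval, k11]
    · simp [evalBlock, Instr.eval, k12]
    · simp [evalBlock, Instr.eval, k13]
    · simp [evalBlock, Instr.eval, k15]
    · simp [evalBlock, Instr.eval, k21]
    · simp [evalBlock, Instr.eval, k13]; omega
    · rw [← hf k hk]
      simp only [List.mem_cons, List.not_mem_nil, or_false, not_or] at hk
      simp [evalBlock, Instr.eval, hk]
  · exact (Spec.skip ⟨k11, k12, k13, k15, k21, by omega, hf⟩).mono_time (by omega)

theorem restrict_spec (hI : IsIndex D n code W ptr rk) (hb : n + 2 < 2 ^ b) {u v : List α}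
    {c lo hi i j : ℕ} (hcn : c ≤ n) (hhi : hi ≤ n) (hlt : lo < hi) (hij : i ≤ j) (hjc : j ≤ c)
    (hilo : i * u.length ≤ lo) (hjhi : j * u.length ≤ hi)
    (hne : i < j → lo < (i + 1) * u.length) {ρ : ℕ → ℕ} (h1 : ρ 1 = 1) (h11 : ρ 11 = ptr u)
    (h12 : ρ 12 = ptr v) (h13 : ρ 13 = c) (h15 : ρ 15 = u.length) (h16 : ρ 16 = lo)
    (h17 : ρ 17 = hi) (h21 : ρ 21 = i) (h22 : ρ 22 = j) :
    Spec D s M (restrict M) 15 ρ fun ρ' => ρ' 5 = ptr (if j = c then v else u) ∧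
      (∀ k, k ∈ [0, 1, 2, 3, 4] → ρ' k = ρ k) ∧
      (i = j → ρ' 16 = lo - i * u.length ∧ ρ' 17 = hi - i * u.length ∧ ρ' 18 = ρ 18 ∧
        ρ' 19 = ρ 19 ∧ ρ' 20 = ρ 20) ∧
      (i < j → ρ' 16 = 0 ∧ ρ' 17 = hi - j * u.length ∧ ρ' 18 = ptr u ∧
        ρ' 19 = (i + 1) * u.length - lo ∧ ρ' 20 = j - i - 1) := by
  have hD := hI.length_le
  refine Spec.mono_time (t₁ := 12 + 3) ?_ le_rfl
  refine Spec.seq (Spec.mono (t₁ := 12) (Post' := fun ρ₁ =>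
    (ρ₁ 11 = ptr u ∧ ρ₁ 12 = ptr v ∧ ρ₁ 13 = c ∧ ρ₁ 22 = j) ∧
    (∀ k, k ∈ [0, 1, 2, 3, 4] → ρ₁ k = ρ k) ∧
    (i = j → ρ₁ 16 = lo - i * u.length ∧ ρ₁ 17 = hi - i * u.length ∧ ρ₁ 18 = ρ 18 ∧
      ρ₁ 19 = ρ 19 ∧ ρ₁ 20 = ρ 20) ∧
    (i < j → ρ₁ 16 = 0 ∧ ρ₁ 17 = hi - j * u.length ∧ ρ₁ 18 = ptr u ∧
      ρ₁ 19 = (i + 1) * u.length - lo ∧ ρ₁ 20 = j - i - 1)) ?_ le_rfl ?_)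
  · refine Spec.ite_eq (by rw [h21]; omega) (by rw [h22]; omega) (fun he => ?_) (fun hn => ?_)
    · rw [h21, h22] at he
      refine Spec.mono_time (Spec.block hD _ ?_ ⟨⟨?_, ?_, ?_, ?_⟩, fun k hk => ?_,
        fun _ => ⟨?_, ?_, ?_, ?_, ?_⟩, fun h => absurd he h.ne⟩) (by simp)
      · simp [OkBlock, Instr.Ok, Instr.eval, h15, h16, h17, h21]; omega
      · simp [evalBlock, Instr.eval, h11]
      · simp [evalBlock, Instr.eval, h12]
      · simp [evalBlock, Instr.eval, h13]
      · simp [evalBlock, Instr.eval, h22]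
      · simp only [List.mem_cons, List.not_mem_nil, or_false] at hk
        rcases hk with rfl | rfl | rfl | rfl | rfl <;> simp [evalBlock, Instr.eval]
      · simp [evalBlock, Instr.eval, h15, h16, h21]
      · simp [evalBlock, Instr.eval, h15, h17, h21]
      · simp [evalBlock, Instr.eval]
      · simp [evalBlock, Instr.eval]
      · simp [evalBlock, Instr.eval]
    · rw [h21, h22] at hn
      have hij' : i < j := lt_of_le_of_ne hij hn
      have hlo' := hne hij'
      have h3 : (1 + i) * u.length ≤ hi := by
        rw [add_comm]
        exact (Nat.mul_le_mul_right _ hij').trans hjhi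
      refine Spec.mono_time (Spec.block hD _ ?_ ⟨⟨?_, ?_, ?_, ?_⟩, fun k hk => ?_,
        fun h => absurd h hn, fun _ => ⟨?_, ?_, ?_, ?_, ?_⟩⟩) (by simp)
      · simp [OkBlock, Instr.Ok, Instr.eval, h15, h16, h17, h21, h22, h1]
        rw [add_comm] at hlo'
        omega
      · simp [evalBlock, Instr.eval, h11]
      · simp [evalBlock, Instr.eval, h12]
      · simp [evalBlock, Instr.eval, h13]
      · simp [evalBlock, Instr.eval, h22]
      · simp only [List.mem_cons, List.not_mem_nil, or_false] at hk
        rcases hk with rfl | rfl | rfl | rfl | rfl <;> simp [evalBlock, Instr.eval]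
      · simp [evalBlock, Instr.eval]
      · simp [evalBlock, Instr.eval, h15, h17, h22]
      · simp [evalBlock, Instr.eval, h11]
      · simp [evalBlock, Instr.eval, h15, h16, h21, add_comm]
      · simp [evalBlock, Instr.eval, h21, h22, h1]
  rintro ρ₁ ⟨⟨m11, m12, m13, m22⟩, mf, meq, mne⟩
  have key : ∀ a p, ρ₁ a = p → p = ptr (if j = c then v else u) →
      Spec D s M (block M [.move 5 a]) 2 ρ₁ fun ρ' => ρ' 5 = ptr (if j = c then v else u) ∧
      (∀ k, k ∈ [0, 1, 2, 3, 4] → ρ' k = ρ k) ∧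
      (i = j → ρ' 16 = lo - i * u.length ∧ ρ' 17 = hi - i * u.length ∧ ρ' 18 = ρ 18 ∧
        ρ' 19 = ρ 19 ∧ ρ' 20 = ρ 20) ∧
      (i < j → ρ' 16 = 0 ∧ ρ' 17 = hi - j * u.length ∧ ρ' 18 = ptr u ∧
        ρ' 19 = (i + 1) * u.length - lo ∧ ρ' 20 = j - i - 1) := by
    intro a p ha hp
    refine Spec.block hD _ (by simp [OkBlock, Instr.Ok]) ⟨?_, fun k hk => ?_, fun h => ?_,
      fun h => ?_⟩
    · simp [evalBlock, Instr.eval, ha, hp]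
    · rw [← mf k hk]
      simp only [List.mem_cons, List.not_mem_nil, or_false] at hk
      rcases hk with rfl | rfl | rfl | rfl | rfl <;> simp [evalBlock, Instr.eval]
    · simpa [evalBlock, Instr.eval] using meq h
    · simpa [evalBlock, Instr.eval] using mne h
  refine Spec.ite_eq (t := 2) (by rw [m22]; omega) (by rw [m13]; omega) (fun he => ?_)
    (fun hn => ?_)
  · rw [m22, m13] at he
    exact key 12 _ m12 (by rw [if_pos he])
  · rw [m22, m13] at hn
    exact key 11 _ m11 (by rw [if_neg hn])

theorem descend_spec (hI : IsIndex D n code W ptr rk) (hb : n + 2 < 2 ^ b) (R r : ℕ) (hrR : r ≤ R) :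
    ∀ (x z : List α) (lo hi : ℕ) (ρ : ℕ → ℕ), x ∈ W → rk x = r → z ∈ W → rk z ≤ R → lo < hi →
      hi ≤ x.length → Consts ρ → ρ 5 = ptr x → ρ 16 = lo → ρ 17 = hi → ρ 18 = ptr z → ρ 19 = 0 →
      ρ 20 = 0 →
    Spec D s M (descend M) (40 * (r + 1)) ρ fun ρ' => Split W ptr rk R ((x.take hi).drop lo) ρ' ∧
      ∀ i, i ∈ [0, 1, 2, 3, 4] → ρ' i = ρ i := by
  induction r using Nat.strong_induction_on with
  | _ r ih =>
  intro x z lo hi ρ hx hr hz hzR hlt hhi hc h5 h16 h17 h18 h19 h20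
  have hD := hI.length_le
  have hxn := hI.le x hx
  obtain ⟨h0, h1, h2⟩ := hc
  rcases Nat.eq_zero_or_pos lo with rfl | hlo0
  · refine (Spec.loop_exit (by rw [h0]; omega) (by rw [h16]; omega) (by rw [h0, h16])
      ⟨⟨z, hz, x, hx, 0, 0, hi, by simp, by simp, hhi, hzR, by simp, by omega, h18, h19, h20, h5,
        h17⟩, fun _ _ => rfl⟩).mono_time (by omega)
  obtain ⟨u, hu, v, hv, c, hc1, hxe, -, hru, hrv, f2, f3, f4⟩ := hI.rule x hx (by omega)
  have hupos := List.length_pos_of_ne_nil (hI.ne_nil u hu)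
  have hlen : x.length = c * u.length + v.length := by
    conv_lhs => rw [hxe]
    simp
  have hcx : c ≤ x.length := by nlinarith
  obtain ⟨i, hi_def⟩ : ∃ i, i = min (lo / u.length) c := ⟨_, rfl⟩
  obtain ⟨j, hj_def⟩ : ∃ j, j = min ((hi - 1) / u.length) c := ⟨_, rfl⟩
  obtain ⟨hij, hjc, hilo, hjhi, hyl, heq, hne⟩ :=
    drop_take_pw hupos hlt (hlen ▸ hhi) hi_def hj_def
  have hloc := locate_spec (s := s) (M := M) hI hb hx hu (hcx.trans hxn) hlt (hhi.trans hxn)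
    f2 f3 f4 h1 h5 h16 h17
  rw [← hi_def, ← hj_def] at hloc
  rw [← hxe] at heq hne
  obtain ⟨y, hy_def⟩ : ∃ y, y = if j = c then v else u := ⟨_, rfl⟩
  have hy : y ∈ W := by rw [hy_def]; split_ifs <;> assumption
  have hry : rk y + Nat.log 2 c < rk x := by rw [hy_def]; split_ifs <;> assumption
  rw [← hy_def] at heq hne hyl
  clear hi_def hj_def hxe
  refine Spec.mono_time (t₁ := (20 + 15) + 40 * (rk y + 1) + 1) ?_ (by omega)
  refine Spec.loop_step (by rw [h0]; omega) (by rw [h16]; omega) (by rw [h0, h16]; exact hlo0) ?_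
  refine Spec.seq (hloc.mono le_rfl ?_)
  rintro ρ₁ ⟨e11, e12, e13, e15, e21, e22, ef⟩
  refine (restrict_spec hI hb (hcx.trans hxn) (hhi.trans hxn) hlt hij hjc hilo hjhi
    (fun h => (hne h).1) ((ef 1 (by simp)).trans h1) e11 e12 e13 e15 ((ef 16 (by simp)).trans h16)
    ((ef 17 (by simp)).trans h17) e21 e22).mono le_rfl ?_
  rintro ρ₂ ⟨g5, gf, geq, gne⟩
  rw [← hy_def] at g5
  have hframe : ∀ k, k ∈ [0, 1, 2, 3, 4] → ρ₂ k = ρ k := fun k hk => by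
    rw [gf k hk]
    refine ef k ?_
    simp only [List.mem_cons, List.not_mem_nil, or_false] at hk
    rcases hk with rfl | rfl | rfl | rfl | rfl <;> simp
  have g0 : ρ₂ 0 = 0 := (hframe 0 (by simp)).trans h0
  have g1 : ρ₂ 1 = 1 := (hframe 1 (by simp)).trans h1
  have g2 : ρ₂ 2 = 2 := (hframe 2 (by simp)).trans h2
  rcases hij.eq_or_lt with he | he
  · obtain ⟨h6, h7⟩ := heq he
    obtain ⟨g16, g17, g18, g19, g20⟩ := geq he
    refine (ih (rk y) (by omega) (by omega) y z _ _ ρ₂ hy rfl hz hzR h6 (he ▸ hyl)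
      ⟨g0, g1, g2⟩ g5 g16 g17 (g18.trans ((ef 18 (by simp)).trans h18))
      (g19.trans ((ef 19 (by simp)).trans h19))
      (g20.trans ((ef 20 (by simp)).trans h20))).mono le_rfl ?_
    rintro ρ₃ ⟨hs, h8⟩
    exact ⟨h7 ▸ hs, fun k hk => (h8 k hk).trans (hframe k hk)⟩
  · obtain ⟨h6, h7⟩ := hne he
    obtain ⟨g16, g17, g18, g19, g20⟩ := gne he
    have hlog : Nat.log 2 (j - i - 1) ≤ Nat.log 2 c := Nat.log_mono_right (by omega)
    have h9 : (i + 1) * u.length - lo ≤ u.length := by rw [add_one_mul]; omega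
    exact (Spec.loop_exit (by rw [g0]; omega) (by rw [g16]; omega) (by rw [g0, g16])
      ⟨⟨u, hu, y, hy, _, _, _, h7, h9, hyl, by omega, by omega, by omega, g18, g19, g20, g5, g17⟩,
        hframe⟩).mono_time (by omega)

end WordRAM

namespace WordRAM

variable {α : Type*} {b : ℕ} {D : List (BitVec b)} {s M n t : ℕ} {H : Prog}
  {code : List α → ℕ} {W : Set (List α)} {ptr rk : List α → ℕ}

/-! ### The query program -/

/-- The value of the nonempty factor from position `16` to position `17`, both inclusive, of the word
whose address is in cell `1`: append a suffix, a power and a prefix to the accumulator. -/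
def factor (M : ℕ) (H : Prog) : Prog :=
  .seq (block M [.sub 16 16 1, .read 5 1, .move 18 5, .const 19 0, .const 20 0])
    (.seq (descend M) (.seq (block M [.move 24 5, .move 5 18, .move 6 19])
      (.seq (walk M H true) (.seq (block M [.const 14 1, .add 14 14 18, .read 8 14, .read 9 18,
          .move 7 20])
        (.seq (power M H false) (.seq (block M [.move 5 24, .move 6 17]) (walk M H false)))))))

theorem factor_spec (hI : IsIndex D n code W ptr rk) (hb : n + 2 < 2 ^ b)
    (hH : Evaluates D s M H n t code) {w : List α} (hw : w ∈ W) {R i j : ℕ} (hR : rk w ≤ R)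
    (h1D : cell D 1 = ptr w) (hi : 1 ≤ i) (hij : i ≤ j) (hj : j ≤ w.length) {ρ : ℕ → ℕ}
    (hc : Consts ρ) (hA : Acc code ρ ([] : List α)) (h16 : ρ 16 = i) (h17 : ρ 17 = j) :
    Spec D s M (factor M H) ((6 * t + 151) * (R + 1)) ρ fun ρ' =>
      Acc code ρ' (substr w i j) := by
  have hD := hI.length_le
  have hwlt := hI.lt w hw
  have hwn := hI.le w hw
  obtain ⟨h0, h1, h2⟩ := hc
  refine Spec.mono_time (t₁ := 6 + (40 * (R + 1) + (4 + ((2 * t + 40) * (R + 1) + (6 +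
    (((2 * t + 11) * (R + 1) + 1) + (3 + (2 * t + 40) * (R + 1)))))))) ?_ (by nlinarith)
  refine Spec.seq (Spec.block hD _ ?_ ?_)
  · simp [OkBlock, Instr.Ok, Instr.eval, h1, h16]
    omega
  set ρ₁ := evalBlock D [.sub 16 16 1, .read 5 1, .move 18 5, .const 19 0, .const 20 0] ρ with hρ₁
  have e0 : ρ₁ 0 = 0 := by simp [hρ₁, evalBlock, Instr.eval, h0]
  have e1 : ρ₁ 1 = 1 := by simp [hρ₁, evalBlock, Instr.eval, h1]
  have e2 : ρ₁ 2 = 2 := by simp [hρ₁, evalBlock, Instr.eval, h2]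
  have e3 : ρ₁ 3 = code [] := by simp [hρ₁, evalBlock, Instr.eval, hA.1]
  have e4 : ρ₁ 4 = 0 := by simp [hρ₁, evalBlock, Instr.eval, hA.2]
  have e5 : ρ₁ 5 = ptr w := by simp [hρ₁, evalBlock, Instr.eval, h1, h1D]
  have e16 : ρ₁ 16 = i - 1 := by simp [hρ₁, evalBlock, Instr.eval, h1, h16]
  have e17 : ρ₁ 17 = j := by simp [hρ₁, evalBlock, Instr.eval, h17]
  have e18 : ρ₁ 18 = ptr w := by simp [hρ₁, evalBlock, Instr.eval, h1, h1D]
  have e19 : ρ₁ 19 = 0 := by simp [hρ₁, evalBlock, Instr.eval]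
  have e20 : ρ₁ 20 = 0 := by simp [hρ₁, evalBlock, Instr.eval]
  clear_value ρ₁
  refine Spec.seq ((descend_spec hI hb R (rk w) hR w w (i - 1) j ρ₁ hw rfl hw hR (by omega) hj
    ⟨e0, e1, e2⟩ e5 e16 e17 e18 e19 e20).mono (by gcongr) ?_)
  rintro ρ₂ ⟨⟨x, hx, y, hy, m, q, m', hX, hm, hm', hxR, hqR, hyR, g18, g19, g20, g5, g17⟩, gf⟩
  have hlen : m + (q * x.length + m') ≤ n := by
    have := congrArg List.length hX
    simp only [List.length_drop, List.length_take, List.length_append, length_pw,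
      length_part true x m hm] at this
    omega
  have hxlt := hI.lt x hx
  have hlenx := hI.len x hx
  have hvalx := hI.val x hx
  rw [add_comm] at hvalx
  refine Spec.seq (Spec.block hD _ (by simp [OkBlock, Instr.Ok]) ?_)
  set ρ₃ := evalBlock D [.move 24 5, .move 5 18, .move 6 19] ρ₂ with hρ₃
  have k : ∀ l, l ∈ [0, 1, 2, 3, 4] → ρ₃ l = ρ₁ l := fun l hl => by
    rw [← gf l hl]
    simp only [List.mem_cons, List.not_mem_nil, or_false] at hl
    rcases hl with rfl | rfl | rfl | rfl | rfl <;> simp [hρ₃, evalBlock, Instr.eval]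
  have k5 : ρ₃ 5 = ptr x := by simp [hρ₃, evalBlock, Instr.eval, g18]
  have k6 : ρ₃ 6 = m := by simp [hρ₃, evalBlock, Instr.eval, g19]
  have k17 : ρ₃ 17 = m' := by simp [hρ₃, evalBlock, Instr.eval, g17]
  have k18 : ρ₃ 18 = ptr x := by simp [hρ₃, evalBlock, Instr.eval, g18]
  have k20 : ρ₃ 20 = q := by simp [hρ₃, evalBlock, Instr.eval, g20]
  have k24 : ρ₃ 24 = ptr y := by simp [hρ₃, evalBlock, Instr.eval, g5]
  have k0 := (k 0 (by simp)).trans e0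
  have k1 := (k 1 (by simp)).trans e1
  have k2 := (k 2 (by simp)).trans e2
  clear_value ρ₃
  refine Spec.seq ((walk_spec hI hb hH true (rk x) x m [] ρ₃ hx rfl hm (by simp; omega)
    ⟨k0, k1, k2⟩ ⟨(k 3 (by simp)).trans e3, (k 4 (by simp)).trans e4⟩ k5 k6).mono (by gcongr) ?_)
  rintro ρ₄ ⟨hA₄, lf⟩
  refine Spec.seq (Spec.block hD _ ?_ ?_)
  · simp [OkBlock, Instr.Ok, Instr.eval, lf 18 (by simp), k18]
    omega
  set ρ₅ := evalBlock D [.const 14 1, .add 14 14 18, .read 8 14, .read 9 18, .move 7 20] ρ₄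
    with hρ₅
  have mf : ∀ l, l ∉ [3, 4, 5, 6, 7, 8, 9, 10, 11, 12, 13, 14, 23] → ρ₅ l = ρ₃ l := fun l hl => by
    rw [← lf l hl]
    simp only [List.mem_cons, List.not_mem_nil, or_false, not_or] at hl
    simp [hρ₅, evalBlock, Instr.eval, hl]
  have m7 : ρ₅ 7 = q := by simp [hρ₅, evalBlock, Instr.eval, lf 20 (by simp), k20]
  have m8 : ρ₅ 8 = code x := by
    simp [hρ₅, evalBlock, Instr.eval, lf 18 (by simp), k18, hvalx]
  have m9 : ρ₅ 9 = x.length := by simp [hρ₅, evalBlock, Instr.eval, lf 18 (by simp), k18, hlenx]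
  have hA₅ : Acc code ρ₅ (part true x m) := by
    have : join true [] (part true x m) = part true x m := by simp [join]
    rw [this] at hA₄
    exact ⟨by simp [hρ₅, evalBlock, Instr.eval, hA₄.1], by simp [hρ₅, evalBlock, Instr.eval, hA₄.2]⟩
  clear_value ρ₅
  have m0 := (mf 0 (by simp)).trans k0
  have m1 := (mf 1 (by simp)).trans k1
  have m2 := (mf 2 (by simp)).trans k2
  refine Spec.seq ((power_spec hD hb hH false ⟨m0, m1, m2⟩ hA₅ m7 m8 m9 (hI.ne_nil x hx)
    (by rw [length_part true x m hm]; omega)).mono (by gcongr) ?_)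
  rintro ρ₆ ⟨hA₆, nf⟩
  refine Spec.seq (Spec.block hD _ (by simp [OkBlock, Instr.Ok]) ?_)
  set ρ₇ := evalBlock D [.move 5 24, .move 6 17] ρ₆ with hρ₇
  have p : ∀ l, l ∉ [3, 4, 5, 6, 7, 8, 9, 23] → ρ₇ l = ρ₅ l := fun l hl => by
    simp only [List.mem_cons, List.not_mem_nil, or_false, not_or] at hl
    rw [← nf l (by simp; tauto)]
    simp [hρ₇, evalBlock, Instr.eval, hl]
  have p5 : ρ₇ 5 = ptr y := by
    simp [hρ₇, evalBlock, Instr.eval, nf 24 (by simp), mf 24 (by simp), k24]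
  have p6 : ρ₇ 6 = m' := by
    simp [hρ₇, evalBlock, Instr.eval, nf 17 (by simp), mf 17 (by simp), k17]
  have hA₇ : Acc code ρ₇ (join false (part true x m) (pw x q)) :=
    ⟨by simp [hρ₇, evalBlock, Instr.eval, hA₆.1], by simp [hρ₇, evalBlock, Instr.eval, hA₆.2]⟩
  refine (walk_spec hI hb hH false (rk y) y m' _ ρ₇ hy rfl hm'
    (by rw [length_join, length_part true x m hm, length_pw]; omega)
    ⟨(p 0 (by simp)).trans m0, (p 1 (by simp)).trans m1, (p 2 (by simp)).trans m2⟩ hA₇ p5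
    p6).mono (by gcongr) ?_
  rintro ρ₈ ⟨hA₈, -⟩
  rwa [join_assoc, show join false (part true x m) (join false (pw x q) (part false y m')) =
    substr w i j from hX.symm] at hA₈

/-- The query program: move the arguments to registers of its own, and answer a query for an empty
factor at once. -/
def query (M : ℕ) (H : Prog) : Prog :=
  .seq (.move (M + 16) 0) (.seq (.move (M + 17) 1)
    (.seq (block M [.const 0 0, .const 1 1, .const 2 2, .read 3 0, .const 4 0])
      (.seq (.ite (.lt (M + 17) (M + 16)) .skip (factor M H)) (.move 0 (M + 3)))))

theorem query_computes (hI : IsIndex D n code W ptr rk) (hb : n + 2 < 2 ^ b)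
    (hH : Evaluates D s M H n t code) {w : List α} (hw : w ∈ W) {R i j : ℕ} (hR : rk w ≤ R)
    (h0D : cell D 0 = code []) (h1D : cell D 1 = ptr w) (hi : 1 ≤ i) (hin : i ≤ n)
    (hj : j ≤ w.length) :
    (query M H).Computes D s ((6 * t + 151) * (R + 1) + 10) [BitVec.ofNat b i, BitVec.ofNat b j]
      (BitVec.ofNat b (code (substr w i j))) := by
  intro σ hσ
  have hD := hI.length_le
  have hwlt := hI.lt w hw
  have hwn := hI.le w hw
  have a0 : σ.reg 0 = BitVec.ofNat b i := hσ 0 (by simp)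
  have a1 : σ.reg 1 = BitVec.ofNat b j := hσ 1 (by simp)
  set σ₁ := σ.setReg (M + 16) (σ.reg 0) with hσ₁
  set σ₂ := σ₁.setReg (M + 17) (σ₁.reg 1) with hσ₂
  have h16 : σ₂.reg (M + 16) = BitVec.ofNat b i := by simp [hσ₂, hσ₁, State.setReg, a0]
  have h17 : σ₂.reg (M + 17) = BitVec.ofNat b j := by
    simp [hσ₂, hσ₁, State.setReg, a1]
  obtain ⟨ρ₀, hρ₀⟩ : ∃ ρ₀ : ℕ → ℕ, ρ₀ = fun k => (σ₂.reg (M + k)).toNat := ⟨_, rfl⟩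
  have hholds : Holds M σ₂ ρ₀ := fun k => by simp [hρ₀]
  have k16 : ρ₀ 16 = i := by
    simp only [hρ₀, h16, BitVec.toNat_ofNat]
    exact Nat.mod_eq_of_lt (by omega)
  have k17 : ρ₀ 17 = j := by
    simp only [hρ₀, h17, BitVec.toNat_ofNat]
    exact Nat.mod_eq_of_lt (by omega)
  have spec : Spec D s M
      (.seq (block M [.const 0 0, .const 1 1, .const 2 2, .read 3 0, .const 4 0])
        (.ite (.lt (M + 17) (M + 16)) .skip (factor M H)))
      (6 + ((6 * t + 151) * (R + 1) + 1)) ρ₀ fun ρ' => ρ' 3 = code (substr w i j) := by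
    refine Spec.seq (Spec.block hD _ ?_ ?_)
    · simp [OkBlock, Instr.Ok, Instr.eval]
      omega
    set ρ := evalBlock D [.const 0 0, .const 1 1, .const 2 2, .read 3 0, .const 4 0] ρ₀ with hρ
    have e0 : ρ 0 = 0 := by simp [hρ, evalBlock, Instr.eval]
    have e1 : ρ 1 = 1 := by simp [hρ, evalBlock, Instr.eval]
    have e2 : ρ 2 = 2 := by simp [hρ, evalBlock, Instr.eval]
    have e3 : ρ 3 = code [] := by simp [hρ, evalBlock, Instr.eval, h0D]
    have e4 : ρ 4 = 0 := by simp [hρ, evalBlock, Instr.eval]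
    have e16 : ρ 16 = i := by simp [hρ, evalBlock, Instr.eval, k16]
    have e17 : ρ 17 = j := by simp [hρ, evalBlock, Instr.eval, k17]
    clear_value ρ
    refine Spec.ite_lt (by rw [e17]; omega) (by rw [e16]; omega) (fun hlt => ?_) (fun hle => ?_)
    · rw [e16, e17] at hlt
      have hnil : substr w i j = [] := List.drop_eq_nil_of_le (by simp; omega)
      exact (Spec.skip (by rw [e3, hnil])).mono_time (Nat.succ_le_of_lt (by positivity))
    · rw [e16, e17] at hle
      exact (factor_spec hI hb hH hw hR h1D hi hle hj ⟨e0, e1, e2⟩ ⟨e3, e4⟩ e16 e17).mono le_rfl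
        fun ρ' h => h.1
  obtain ⟨t', ht', σ₃, ρ', hex, hρ', h3⟩ := spec σ₂ hholds
  cases hex with
  | @seq _ _ _ σ₄ _ t₁ t₂ hex₁ hex₂ =>
    refine ⟨1 + (1 + (t₁ + (t₂ + 1))), by omega, _, .seq (.move _ _ _) (.seq (.move _ _ _)
      (.seq hex₁ (.seq hex₂ (.move _ _ _)))), ?_⟩
    simp [State.setReg, hρ' 3, h3]

/-! ### Construction of the index -/

/-- The rule by which a derived word that is not a single symbol has been obtained. -/
theorem _root_.Der.exists_rule {W : Finset (List α)} {x : List α} {d : ℕ} (h : Der W x d)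
    (hx : 2 ≤ x.length) : ∃ u v c, 1 ≤ c ∧ x = pw u c ++ v ∧ (c = 1 ∨ u = v) ∧
      ∃ e, Der W u e ∧ Der W v e ∧ e + Nat.log 2 c < d := by
  cases h with
  | leaf h => simp at hx
  | cat hu hv hd h => exact ⟨_, _, 1, le_rfl, by rw [pw_one], Or.inl rfl, _, hu, hv, by simpa⟩
  | @run u t d' _ hu ht hd h =>
    refine ⟨u, u, t - 1, by omega, ?_, Or.inr rfl, d', hu, hu, ?_⟩
    · obtain ⟨k, rfl⟩ : ∃ k, t = k + 1 := ⟨t - 1, by omega⟩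
      rw [Nat.add_sub_cancel]
      exact (pw_add u k 1).trans (by rw [pw_one])
    · have : Nat.log 2 (t - 1) ≤ Nat.log 2 t := Nat.log_mono_right (by omega)
      omega

/-- The array whose record `r`, for `r ≤ N`, holds `field r 0, …, field r 4`. -/
def records (b N : ℕ) (field : ℕ → ℕ → ℕ) : List (BitVec b) :=
  (List.range (5 * (N + 1))).map fun i => BitVec.ofNat b (field (i / 5) (i % 5))

theorem length_records (N : ℕ) (field : ℕ → ℕ → ℕ) :
    (records b N field).length = 5 * (N + 1) := by
  simp [records]

theorem cell_records {N r j : ℕ} {field : ℕ → ℕ → ℕ} (hr : r ≤ N) (hj : j < 5)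
    (h : field r j < 2 ^ b) : cell (records b N field) (5 * r + j) = field r j := by
  have h1 : 5 * r + j < 5 * (N + 1) := by omega
  rw [cell, List.getD_eq_getElem _ _ (by rwa [length_records])]
  simp only [records, List.getElem_map, List.getElem_range, BitVec.toNat_ofNat]
  rw [show (5 * r + j) / 5 = r by omega, show (5 * r + j) % 5 = j by omega, Nat.mod_eq_of_lt h]

/-- A derivation of `w` in `W₀` yields an index with one record per word of `W₀`, and one more record
for the value of the empty word and the address of `w`. -/
theorem exists_index {W₀ : Finset (List α)} {w : List α} {R : ℕ} (hw : Der W₀ w R)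
    (hcode : ∀ x, code x < 2 ^ b) (hn : w.length < 2 ^ b) (hb : 5 * (W₀.card + 1) ≤ 2 ^ b) :
    ∃ (D : List (BitVec b)) (W : Set (List α)) (ptr rk : List α → ℕ),
      D.length = 5 * (W₀.card + 1) ∧ IsIndex D w.length code W ptr rk ∧ w ∈ W ∧ rk w ≤ R ∧
      cell D 0 = code [] ∧ cell D 1 = ptr w := by
  classical
  -- the rank is the least possible one, so that it depends on the word only
  obtain ⟨rk, hrk⟩ : ∃ rk : List α → ℕ, rk = fun x => sInf {d | Der W₀ x d} := ⟨_, rfl⟩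
  have hder : ∀ {x d}, Der W₀ x d → Der W₀ x (rk x) := fun {x d} h => by
    rw [hrk]; exact Nat.sInf_mem (s := {d | Der W₀ x d}) ⟨d, h⟩
  have hle : ∀ {x d}, Der W₀ x d → rk x ≤ d := fun {x d} h => by
    rw [hrk]; exact Nat.sInf_le h
  have hrule : ∀ x, ∃ p : List α × List α × ℕ, Der W₀ x (rk x) → 2 ≤ x.length → 1 ≤ p.2.2 ∧
      x = pw p.1 p.2.2 ++ p.2.1 ∧ (p.2.2 = 1 ∨ p.1 = p.2.1) ∧
      ∃ e, Der W₀ p.1 e ∧ Der W₀ p.2.1 e ∧ e + Nat.log 2 p.2.2 < rk x := fun x => by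
    by_cases h : Der W₀ x (rk x) ∧ 2 ≤ x.length
    · obtain ⟨u, v, c, h⟩ := h.1.exists_rule h.2
      exact ⟨(u, v, c), fun _ _ => h⟩
    · exact ⟨([], [], 0), fun h1 h2 => absurd ⟨h1, h2⟩ h⟩
  choose rhs hrhs using hrule
  set L := W₀.toList with hL
  have hLlen : L.length = W₀.card := W₀.length_toList
  set ptr : List α → ℕ := fun x => 5 * (L.idxOf x + 1) with hptr
  set field : ℕ → ℕ → ℕ := fun r j => if r = 0 then if j = 0 then code [] else ptr w else
    match j with
    | 0 => (L.getD (r - 1) []).length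
    | 1 => code (L.getD (r - 1) [])
    | 2 => ptr (rhs (L.getD (r - 1) [])).1
    | 3 => ptr (rhs (L.getD (r - 1) [])).2.1
    | _ => (rhs (L.getD (r - 1) [])).2.2 with hfield
  have hidx : ∀ {x d}, Der W₀ x d → L.idxOf x < W₀.card := fun h => by
    rw [← hLlen]; exact List.idxOf_lt_length_of_mem (Finset.mem_toList.mpr h.mem)
  have hget : ∀ {x d}, Der W₀ x d → L.getD (L.idxOf x + 1 - 1) [] = x := fun h => by
    rw [Nat.add_sub_cancel, List.getD_eq_getElem _ _ (by rw [hLlen]; exact hidx h),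
      List.getElem_idxOf]
  have hptrlt : ∀ {x d}, Der W₀ x d → ptr x + 4 < 5 * (W₀.card + 1) := fun h => by
    have := hidx h
    simp only [hptr]
    omega
  have hcell : ∀ {x d}, Der W₀ x d → ∀ j < 5, field (L.idxOf x + 1) j < 2 ^ b →
      cell (records b W₀.card field) (ptr x + j) = field (L.idxOf x + 1) j := fun h j hj hlt =>
    cell_records (hidx h) hj hlt
  have hbase : ∀ j < 5, field 0 j < 2 ^ b →
      cell (records b W₀.card field) (5 * 0 + j) = field 0 j := fun j hj hlt =>
    cell_records (Nat.zero_le _) hj hlt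
  have hlen := length_records (b := b) W₀.card field
  have hw' := hptrlt hw
  refine ⟨records b W₀.card field, {x | (∃ d, Der W₀ x d) ∧ x.length ≤ w.length}, ptr, rk, hlen,
    ⟨hlen.trans_le hb, fun x hx => hlen ▸ hptrlt hx.1.choose_spec, fun x hx => hx.2,
      fun x hx => hx.1.choose_spec.ne_nil, ?_, ?_, ?_⟩, ⟨⟨R, hw⟩, le_rfl⟩, hle hw, ?_, ?_⟩
  · rintro x ⟨⟨d, hx⟩, hxn⟩
    have hval : field (L.idxOf x + 1) 0 = x.length := by
      simp only [hfield, Nat.succ_ne_zero, if_false, hget hx]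
    exact (hcell hx 0 (by norm_num) (by omega)).trans hval
  · rintro x ⟨⟨d, hx⟩, -⟩
    have hval : field (L.idxOf x + 1) 1 = code x := by
      simp only [hfield, Nat.succ_ne_zero, if_false, hget hx]
    exact (hcell hx 1 (by norm_num) (by rw [hval]; exact hcode x)).trans hval
  · rintro x ⟨⟨d, hx⟩, hxn⟩ hx2
    obtain ⟨hc, hxe, hor, e, hu, hv, hlt⟩ := hrhs x (hder hx) hx2
    have h2 : field (L.idxOf x + 1) 2 = ptr (rhs x).1 := by
      simp only [hfield, Nat.succ_ne_zero, if_false, hget hx]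
    have h3 : field (L.idxOf x + 1) 3 = ptr (rhs x).2.1 := by
      simp only [hfield, Nat.succ_ne_zero, if_false, hget hx]
    have h4 : field (L.idxOf x + 1) 4 = (rhs x).2.2 := by
      simp only [hfield, Nat.succ_ne_zero, if_false, hget hx]
    have hxlen : x.length = (rhs x).2.2 * (rhs x).1.length + (rhs x).2.1.length := by
      conv_lhs => rw [hxe]
      simp
    have hupos := List.length_pos_of_ne_nil hu.ne_nil
    have hux : (rhs x).1.length ≤ x.length := by nlinarith
    have hcx : (rhs x).2.2 ≤ x.length := by nlinarith
    have hul := hptrlt hu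
    have hvl := hptrlt hv
    have hru := hle hu
    have hrv := hle hv
    exact ⟨_, ⟨⟨e, hu⟩, by omega⟩, _, ⟨⟨e, hv⟩, by omega⟩, _, hc, hxe, hor, by omega, by omega,
      (hcell hx 2 (by norm_num) (by omega)).trans h2,
      (hcell hx 3 (by norm_num) (by omega)).trans h3,
      (hcell hx 4 (by norm_num) (by omega)).trans h4⟩
  · have hval : field 0 0 = code [] := by simp [hfield]
    exact (hbase 0 (by norm_num) (by rw [hval]; exact hcode _)).trans hval
  · have hval : field 0 1 = ptr w := by simp [hfield]
    exact (hbase 1 (by norm_num) (by omega)).trans hval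

end WordRAM

/-! ### The theorem -/

theorem theorem5 :
    ∃ C : ℕ, ∀ H : WordRAM.Prog, ∃ Q : WordRAM.Prog,
      ∀ (α : Type*) (S : Type*) (n k b s T : ℕ) (w : List α)
        (f : List α → S) (h : S → S → ℕ → ℕ → S) (enc : S → BitVec b),
        w.length = n → 2 ≤ n →
        Nat.card S ≤ n ^ k →
        C * n ≤ 2 ^ b → Function.Injective enc →
        (∀ x y : List α, f (x ++ y) = h (f x) (f y) x.length y.length) →
        (∀ (D : List (BitVec b)) (u v : S) (l₁ l₂ : ℕ), l₁ + l₂ ≤ n →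
          H.Computes D s T [enc u, enc v, BitVec.ofNat b l₁, BitVec.ofNat b l₂]
            (enc (h u v l₁ l₂))) →
        ∃ D : List (BitVec b), D.length ≤ C * gRl w ∧
          ∀ i j : ℕ, 1 ≤ i → i ≤ n → j ≤ n →
            Q.Computes D s (C * T * Nat.log 2 n) [BitVec.ofNat b i, BitVec.ofNat b j]
              (enc (f (substr w i j))) := by
  refine ⟨10000, fun H => ⟨WordRAM.query (max 4 H.bound) H, ?_⟩⟩
  intro α S n k b s T w f h enc hwn hn _ hb _ hf hH
  subst hwn
  obtain ⟨W₀, hcard, hder⟩ := exists_balanced_derivation w hn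
  have hg := gRl_le_two_mul_length w hn
  have hg1 : 1 ≤ gRl w := by
    have := Finset.card_pos.mpr ⟨w, hder.mem⟩
    omega
  obtain ⟨D, W, ptr, rk, hlen, hI, hw, hR, h0, h1⟩ :=
    WordRAM.exists_index (b := b) (code := fun x => (enc (f x)).toNat) hder
      (fun x => (enc (f x)).isLt) (by omega) (by omega)
  have hE := WordRAM.evaluates (M := max 4 H.bound) (le_max_left _ _) (le_max_right _ _) hf (hH D)
  -- any run of `H` takes at least one step
  have hT : 1 ≤ T := by
    let args := [enc (f []), enc (f []), BitVec.ofNat b 0, BitVec.ofNat b 0]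
    obtain ⟨t, ht, σ', he, -⟩ := hH D (f []) (f []) 0 0 (by omega)
      ⟨fun i => args.getD i 0, fun _ => 0⟩ fun i hi => List.getD_eq_getElem _ _ hi
    exact he.steps_pos.trans_le ht
  have hlog : 1 ≤ Nat.log 2 w.length := Nat.log_pos (by norm_num) hn
  refine ⟨D, by omega, fun i j hi hin hjn σ hσ => ?_⟩
  obtain ⟨t, ht, σ', he, hres⟩ := WordRAM.query_computes hI (by omega) hE hw hR h0 h1
    hi hin hjn σ hσ
  refine ⟨t, ht.trans ?_, σ', he, ?_⟩
  · -- each of the `R + 1 = 36 log₂ n + 1` levels costs `6 (T + 5) + 151` steps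
    have hTL : T ≤ T * Nat.log 2 w.length := Nat.le_mul_of_pos_right _ hlog
    have hLT : Nat.log 2 w.length ≤ T * Nat.log 2 w.length := Nat.le_mul_of_pos_left _ hT
    calc _ = 216 * (T * Nat.log 2 w.length) + 6 * T + 6516 * Nat.log 2 w.length + 191 := by ring
      _ ≤ 10000 * (T * Nat.log 2 w.length) := by omega
      _ = _ := by ring
  · rw [hres, BitVec.ofNat_toNat, BitVec.setWidth_eq]
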